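/- Let $F$ be a nonarchimedean local field of residual characteristic different from $2$, with maximal ideal $\mathfrak p$ in its ring of integers. Let $G=\mathrm{SL}(2,F)$, let $\mathfrak g=\mathfrak{sl}(2,F)$ with dual $\mathfrak g^*$, and let $\mathcal B(G)$ be the Bruhat--Tits building of $G$. For $x\in\mathcal B(G)$ and $t\in\mathbb R$ let $\mathfrak g_{x,t}$ be the Moy--Prasad filtration, $\mathfrak g_{x,t+}=\bigcup_{s>t}\mathfrak g_{x,s}$, $\mathfrak g^*_{x,t}=\{X\in\mathfrak g^*\mid \langle X,Y\rangle\in\mathfrak p\ \ \forall\, Y\in\mathfrak g_{x,(-t)+}\}$, $\mathfrak g^*_{x,t+}=\bigcup_{s>t}\mathfrak g^*_{x,s}$, and $\mathfrak g^*_{x,\infty}=\bigcap_t \mathfrak g^*_{x,t}=\{0\}$. An element $X\in\mathfrak g^*$ is nilpotent if $\lim_{t\to0}\lambda(t)\cdot X=0$ for some $F$-rational one-parameter subgroup $\lambda$ of $\mathrm{SL}(2)$. For $X\in\mathfrak g^*\setminus\{0\}$ the depth $d_x(X)$ of $X$ at $x$ is the unique $t$ with $X\in\mathfrak g^*_{x,t}\setminus\mathfrak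 g^*_{x,t+}$; the depth of $X$ is $d(X)=\infty$ if $X$ is nilpotent and $d(X)=\max_{x} d_x(X)$ otherwise. When $X+\mathfrak g^*_{x,d+}$, with $d=d_x(X)$, contains a nilpotent element, let $\mathcal O(X,x)$ be the minimal nilpotent $G$-orbit (for the closure relation in the rational topology) meeting this coset. Set $$\mathrm{nil}(X)=\{\mathcal O(X,x)\mid x\in\mathcal B(G),\ d_x(X)<d(X)\},\qquad \mathrm{nil}_x(X)=\{\mathcal O(g\cdot X,x)\mid g\in G,\ d_x(g\cdot X)<d(X)\},$$ $$\mathrm{Cone}(X)=\Bigl\{Z\in\mathfrak g^*\ \Big|\ \exists\,\varepsilon_i\in F^\times,\ \varepsilon_i\to0,\ \exists\, g_i\in G:\ \lim_{i\to\infty}\varepsilon_i^2\, g_i\cdot X=Z\Bigr\}.$$ Let $\Gamma\in\mathfrak g^*\setminus\{0\}$ and $r=d(\Gamma)\in\mathbb R\cup\{\infty\}$. Then: (a) every $\mathcal O\in\mathrm{nil}(\Gamma)$ meets $\Gamma+\mathfrak g^*_{x,r}$ for some $x\in\mathcal B(G)$ with $d_x(\Gamma)<r$; (b) for each $x\in\mathcal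 B(G)$ with $d_x(\Gamma)<r$, if $\Gamma+\mathfrak g^*_{x,r}$ meets a nilpotent orbit $\mathcal O$, then $\mathcal O\in\mathrm{nil}(\Gamma)$; (c) for each $x\in\mathcal B(G)$, $\mathrm{nil}(\Gamma)=\{\mathcal O(g\cdot\Gamma,x)\mid g\in G \text{ such that } \mathcal O(g\cdot\Gamma,x) \text{ is defined}\}=\mathrm{nil}_x(\Gamma)$; moreover every nonzero nilpotent orbit contained in $\mathrm{Cone}(\Gamma)$ belongs to $\mathrm{nil}_x(\Gamma)$. -/

import Mathlib

open Filter Topology ValuativeRel Matrix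
open scoped WithZero

noncomputable section

namespace SL2Nil

/-! ### The normalized valuation of a nonarchimedean local field -/

section Valuation

variable {F : Type*} [Field F] [ValuativeRel F] [TopologicalSpace F] [IsNonarchimedeanLocalField F]

/-- The normalized order of an element, as an integer. It is used only for nonzero elements. -/
def ord (a : F) : ℤ :=
  -WithZero.log (IsNonarchimedeanLocalField.valueGroupWithZeroIsoInt F (valuation F a))

open Classical in
/-- The valuation, normalized so that a uniformizer has valuation `1`, with value `∞` at `0`. -/
def val (a : F) : WithTop ℝ :=
  if a = 0 then ⊤ else (((ord a : ℤ) : ℝ) : WithTop ℝ)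

@[simp] theorem val_zero : val (0 : F) = ⊤ := by simp [val]

theorem val_of_ne {a : F} (ha : a ≠ 0) : val a = (((ord a : ℤ) : ℝ) : WithTop ℝ) := by
  simp [val, ha]

theorem ord_mul {a b : F} (ha : a ≠ 0) (hb : b ≠ 0) : ord (a * b) = ord a + ord b := by
  simp only [ord, map_mul]
  rw [WithZero.log_mul (by simpa using ha) (by simpa using hb)]
  ring

theorem val_mul (a b : F) : val (a * b) = val a + val b := by
  by_cases ha : a = 0
  · simp [ha]
  by_cases hb : b = 0
  · simp [hb]
  rw [val_of_ne ha, val_of_ne hb, val_of_ne (mul_ne_zero ha hb), ord_mul ha hb]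
  push_cast
  rfl

@[simp] theorem val_one : val (1 : F) = 0 := by
  rw [val_of_ne one_ne_zero]
  simp [ord]

theorem val_le_val_iff {a b : F} (ha : a ≠ 0) (hb : b ≠ 0) :
    val a ≤ val b ↔ valuation F b ≤ valuation F a := by
  rw [val_of_ne ha, val_of_ne hb, WithTop.coe_le_coe, Int.cast_le, ord, ord, neg_le_neg_iff,
    WithZero.log_le_log (by simpa using hb) (by simpa using ha)]
  exact map_le_map_iff (IsNonarchimedeanLocalField.valueGroupWithZeroIsoInt F)

theorem le_val_add {t : WithTop ℝ} {a b : F} (ha : t ≤ val a) (hb : t ≤ val b) :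
    t ≤ val (a + b) := by
  by_cases ha0 : a = 0
  · simpa [ha0] using hb
  by_cases hb0 : b = 0
  · simpa [hb0] using ha
  by_cases h0 : a + b = 0
  · simp [h0]
  rcases le_max_iff.1 ((valuation F).map_add a b) with h | h
  · exact ha.trans ((val_le_val_iff ha0 h0).2 h)
  · exact hb.trans ((val_le_val_iff hb0 h0).2 h)

theorem exists_ord_eq (n : ℤ) : ∃ a : F, a ≠ 0 ∧ ord a = n := by
  obtain ⟨a, ha⟩ := ValuativeRel.valuation_surjective
    ((IsNonarchimedeanLocalField.valueGroupWithZeroIsoInt F).symm (WithZero.exp (-n)))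
  refine ⟨a, ?_, ?_⟩
  · rintro rfl
    have := congrArg (IsNonarchimedeanLocalField.valueGroupWithZeroIsoInt F) ha
    simp at this
    exact WithZero.exp_ne_zero this.symm
  · simp [ord, ha]

end Valuation

/-! ### The group `SL(2,F)`, its Lie algebra and the coadjoint action -/

/-- The Lie algebra `𝔤 = 𝔰𝔩(2,F)` of traceless matrices. -/
abbrev LieAlg (F : Type*) [Field F] := LieAlgebra.SpecialLinear.sl (Fin 2) F

/-- The dual `𝔤*` of the Lie algebra. -/
abbrev CoLie (F : Type*) [Field F] := Module.Dual F (LieAlg F)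

/-- The group `G = SL(2,F)`. -/
abbrev Grp (F : Type*) [Field F] := Matrix.SpecialLinearGroup (Fin 2) F

section Action

variable {F : Type*} [Field F]

theorem mem_sl_iff (X : Matrix (Fin 2) (Fin 2) F) :
    X ∈ LieAlgebra.SpecialLinear.sl (Fin 2) F ↔ X.trace = 0 := Iff.rfl

/-- The adjoint action `X ↦ g X g⁻¹`. -/
def Ad (g : Grp F) : LieAlg F →ₗ[F] LieAlg F where
  toFun X := ⟨(g : Matrix (Fin 2) (Fin 2) F) * X.1 * ((g⁻¹ : Grp F) : Matrix (Fin 2) (Fin 2) F), by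
    have hX : X.1.trace = 0 := X.2
    rw [mem_sl_iff, Matrix.trace_mul_comm, ← Matrix.mul_assoc,
      ← Matrix.SpecialLinearGroup.coe_mul, inv_mul_cancel]
    simpa using hX⟩
  map_add' X Y := by
    apply Subtype.ext
    simp [Matrix.mul_add, Matrix.add_mul]
  map_smul' a X := by
    apply Subtype.ext
    simp

theorem Ad_mul (g h : Grp F) (X : LieAlg F) : Ad (g * h) X = Ad g (Ad h X) := by
  apply Subtype.ext
  simp only [Ad, LinearMap.coe_mk, AddHom.coe_mk, _root_.mul_inv_rev, Matrix.SpecialLinearGroup.coe_mul,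
    Matrix.mul_assoc]

theorem Ad_one (X : LieAlg F) : Ad (1 : Grp F) X = X := by
  apply Subtype.ext
  simp [Ad]

/-- The coadjoint action of `SL(2,F)` on `𝔤*`. -/
def coAd (g : Grp F) (X : CoLie F) : CoLie F := X.comp (Ad g⁻¹)

/-- The rational topology on the finite-dimensional space `𝔤*`: its topology as a vector space
over `F`, which is that of evaluation at the elements of `𝔤`. -/
instance coLieTopology [TopologicalSpace F] : TopologicalSpace (CoLie F) :=
  TopologicalSpace.induced (fun (X : CoLie F) (Y : LieAlg F) => X Y) inferInstance

/-- The matrix `(a b; c -a)`. -/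
def mk3 (a b c : F) : LieAlg F := ⟨!![a, b; c, -a], by simp [mem_sl_iff, Matrix.trace_fin_two]⟩

theorem eq_mk3 (X : LieAlg F) : X = mk3 (X.1 0 0) (X.1 0 1) (X.1 1 0) := by
  have h : X.1.trace = 0 := X.2
  rw [Matrix.trace_fin_two] at h
  apply Subtype.ext
  ext i j
  fin_cases i <;> fin_cases j <;> simp [mk3]
  linear_combination h

theorem mk3_eq (a b c : F) : mk3 a b c = a • mk3 1 0 0 + b • mk3 0 1 0 + c • mk3 0 0 1 := by
  apply Subtype.ext
  ext i j
  fin_cases i <;> fin_cases j <;> simp [mk3]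

end Action

/-! ### The Bruhat--Tits building and the Moy--Prasad filtrations -/

section Building

variable {F : Type*} [Field F] [ValuativeRel F] [TopologicalSpace F] [IsNonarchimedeanLocalField F]

/-- The additive norm on `F²` which belongs to the point `x₀ + c α^∨` of the standard apartment,
moved by `g ∈ SL(2,F)`: the basis `g e₁, g e₂` splits it, with values `c` and `-c`. -/
def normOf (g : Grp F) (c : ℝ) (w : Fin 2 → F) : WithTop ℝ :=
  min (val (((g⁻¹ : Grp F) : Matrix (Fin 2) (Fin 2) F).mulVec w 0) + ((c : ℝ) : WithTop ℝ))
    (val (((g⁻¹ : Grp F) : Matrix (Fin 2) (Fin 2) F).mulVec w 1) + ((-c : ℝ) : WithTop ℝ))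

variable (F) in
/-- The Bruhat--Tits building of `SL(2,F)`, as the set of splittable additive norms on `F²` of
volume zero. -/
def Building : Type _ := {N : (Fin 2 → F) → WithTop ℝ // ∃ (g : Grp F) (c : ℝ), N = normOf g c}

/-- The point `g · (x₀ + c α^∨)` of the building; for fixed `g` these are the points of the
apartment of the torus `g T g⁻¹`, with `T` the diagonal torus. -/
def point (g : Grp F) (c : ℝ) : Building F := ⟨normOf g c, g, c, rfl⟩

theorem exists_eq_point (x : Building F) : ∃ (g : Grp F) (c : ℝ), x = point g c := by
  obtain ⟨N, g, c, rfl⟩ := x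
  exact ⟨g, c, rfl⟩

/-- `𝔱_r ⊕ 𝔤_{α,x,r} ⊕ 𝔤_{-α,x,r}` at the point `x = x₀ + c α^∨` of the standard apartment. The
affine roots are `±α + n` with `n` an integer, `α(x) = 2 c`, and `𝔤_{α+n}`, `𝔤_{-α+n}` consist of
the matrices with one entry, of valuation at least `n`. -/
def stdMP (c r : ℝ) : Set (LieAlg F) :=
  {X | (r : WithTop ℝ) ≤ val (X.1 0 0) ∧ ((r - 2 * c : ℝ) : WithTop ℝ) ≤ val (X.1 0 1) ∧
    ((r + 2 * c : ℝ) : WithTop ℝ) ≤ val (X.1 1 0)}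

/-- The Moy--Prasad filtration `𝔤_{x,r}` of the Lie algebra, computed in an apartment that
contains `x`. By `point_mem_iff` below every apartment containing `x` gives the same answer. -/
def lieMP (x : Building F) (r : ℝ) : Set (LieAlg F) :=
  {X | ∃ (g : Grp F) (c : ℝ), x = point g c ∧ Ad g⁻¹ X ∈ stdMP c r}

/-- `𝔤_{x,r+}`, the union of the `𝔤_{x,s}` with `s > r`. -/
def lieMPplus (x : Building F) (r : ℝ) : Set (LieAlg F) := ⋃ s > r, lieMP x s

/-- The Moy--Prasad filtration `𝔤*_{x,r}` of the dual: the functionals which map `𝔤_{x,(-r)+}`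
to the maximal ideal. -/
def coMP (x : Building F) (r : ℝ) : Set (CoLie F) :=
  {X | ∀ Y ∈ lieMPplus x (-r), valuation F (X Y) < 1}

/-- `𝔤*_{x,r+}`, the union of the `𝔤*_{x,s}` with `s > r`. -/
def coMPplus (x : Building F) (r : ℝ) : Set (CoLie F) := ⋃ s > r, coMP x s

/-- `𝔤*_{x,r}` for `r` which may be infinite. It is the usual one for real `r`, and the
intersection of all `𝔤*_{x,s}` (that is, `0`) for `r = ∞`. -/
def coMPExt (x : Building F) (r : EReal) : Set (CoLie F) :=
  ⋂ (s : ℝ) (_ : (s : EReal) ≤ r), coMP x s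

end Building

/-! ### Depth, nilpotent elements and orbits, nilpotent support -/

section Nil

variable {F : Type*} [Field F] [ValuativeRel F] [TopologicalSpace F] [IsNonarchimedeanLocalField F]

/-- The depth `d_x(X)` of `X` at `x`: the real number `t` such that `X` lies in `𝔤*_{x,t}` and
not in `𝔤*_{x,t+}`. For `X ≠ 0` it exists and is unique, see `existsUnique_depthAt`. -/
def depthAt (x : Building F) (X : CoLie F) : ℝ :=
  Classical.epsilon fun t : ℝ => X ∈ coMP x t ∧ X ∉ coMPplus x t

/-- An `F`-rational one-parameter subgroup of `SL(2)`: a homomorphism from the multiplicative group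
which is given by Laurent polynomials. -/
def IsOneParam (φ : Fˣ →* Grp F) : Prop :=
  ∃ P : Fin 2 → Fin 2 → LaurentPolynomial F, ∀ (t : Fˣ) (i j : Fin 2),
    (φ t : Matrix (Fin 2) (Fin 2) F) i j = LaurentPolynomial.eval₂ (RingHom.id F) t (P i j)

/-- `X` is nilpotent: `φ(t) · X` tends to `0` as `t` tends to `0`, for some `F`-rational
one-parameter subgroup `φ`. -/
def IsNilp (X : CoLie F) : Prop :=
  ∃ φ : Fˣ →* Grp F, IsOneParam φ ∧
    Tendsto (fun t : Fˣ => coAd (φ t) X) (comap (fun t : Fˣ => (t : F)) (𝓝 0)) (𝓝 0)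

open Classical in
/-- The depth `d(X)`: infinite for nilpotent `X`, and otherwise the largest `d_x(X)`,
written as a supremum. -/
def depth (X : CoLie F) : EReal :=
  if IsNilp X then ⊤ else ⨆ x : Building F, ((depthAt x X : ℝ) : EReal)

/-- The coadjoint orbit of `X`. -/
def orbit (X : CoLie F) : Set (CoLie F) := Set.range fun g : Grp F => coAd g X

variable (F) in
/-- The set of nilpotent coadjoint orbits. -/
def nilpOrbits : Set (Set (CoLie F)) := {O | ∃ X : CoLie F, IsNilp X ∧ O = orbit X}

/-- The coset `X + L`. -/
def coset (X : CoLie F) (L : Set (CoLie F)) : Set (CoLie F) := (fun Z => X + Z) '' L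

/-- The nilpotent orbits which meet the coset `X + 𝔤*_{x,d+}`, where `d = d_x(X)`. -/
def meetingOrbits (X : CoLie F) (x : Building F) : Set (Set (CoLie F)) :=
  {O | O ∈ nilpOrbits F ∧ (O ∩ coset X (coMPplus x (depthAt x X))).Nonempty}

/-- `O = 𝒪(X,x)`: the coset `X + 𝔤*_{x,d+}`, `d = d_x(X)`, meets a nilpotent orbit (it is
degenerate) and, among the nilpotent orbits that meet it, `O` is the minimum for the closure
relation. -/
def IsOrbitAt (X : CoLie F) (x : Building F) (O : Set (CoLie F)) : Prop :=
  O ∈ meetingOrbits X x ∧ ∀ O' ∈ meetingOrbits X x, O ⊆ closure O'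

/-- The local nilpotent support of `X` at `x`. -/
def nilAt (x : Building F) (X : CoLie F) : Set (Set (CoLie F)) :=
  {O | ∃ g : Grp F, ((depthAt x (coAd g X) : ℝ) : EReal) < depth X ∧ IsOrbitAt (coAd g X) x O}

/-- The nilpotent support of `X`. -/
def nil (X : CoLie F) : Set (Set (CoLie F)) :=
  {O | ∃ x : Building F, ((depthAt x X : ℝ) : EReal) < depth X ∧ IsOrbitAt X x O}

/-- The asymptotic cone on `X`. -/
def cone (X : CoLie F) : Set (CoLie F) :=
  {Z | ∃ (ε : ℕ → Fˣ) (g : ℕ → Grp F), Tendsto (fun i => (ε i : F)) atTop (𝓝 0) ∧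
    Tendsto (fun i => (ε i : F) ^ 2 • coAd (g i) X) atTop (𝓝 Z)}

end Nil

/-! ### The filtrations and the depth at a point are well defined -/

section WellDefined

variable {F : Type*} [Field F] [ValuativeRel F] [TopologicalSpace F] [IsNonarchimedeanLocalField F]

theorem entry_bound {v u : WithTop ℝ} {ρ c d r : ℝ} (h : (ρ : WithTop ℝ) ≤ v)
    (hρ : c + r ≤ ρ + d) :
    u + (c : WithTop ℝ) + (r : WithTop ℝ) ≤ v + u + (d : WithTop ℝ) := by
  induction u using WithTop.recTopCoe with
  | top => simp
  | coe u =>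
    induction v using WithTop.recTopCoe with
    | top => simp
    | coe v =>
      norm_cast at h ⊢
      linarith

theorem le_of_add_bound {v : WithTop ℝ} {ρ c d r : ℝ}
    (h : (c : WithTop ℝ) + (r : WithTop ℝ) ≤ v + (d : WithTop ℝ)) (hρ : ρ + d ≤ c + r) :
    (ρ : WithTop ℝ) ≤ v := by
  induction v using WithTop.recTopCoe with
  | top => simp
  | coe v =>
    norm_cast at h ⊢
    linarith

theorem mem_stdMP_iff_norm (c r : ℝ) (Z : LieAlg F) :
    Z ∈ stdMP c r ↔ ∀ u : Fin 2 → F,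
      min (val (u 0) + (c : WithTop ℝ)) (val (u 1) + ((-c : ℝ) : WithTop ℝ)) + (r : WithTop ℝ) ≤
      min (val (Z.1.mulVec u 0) + (c : WithTop ℝ))
        (val (Z.1.mulVec u 1) + ((-c : ℝ) : WithTop ℝ)) := by
  have h11 : Z.1 1 1 = -Z.1 0 0 := by
    have h : Z.1.trace = 0 := Z.2
    rw [Matrix.trace_fin_two] at h
    linear_combination h
  have hneg : ∀ a : F, val (-a) = val a := fun a => by
    by_cases ha : a = 0
    · simp [ha]
    · apply le_antisymm
      · rw [val_le_val_iff (neg_ne_zero.2 ha) ha, Valuation.map_neg]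
      · rw [val_le_val_iff ha (neg_ne_zero.2 ha), Valuation.map_neg]
  constructor
  · rintro ⟨h1, h2, h3⟩ u
    have h4 : (r : WithTop ℝ) ≤ val (Z.1 1 1) := by rw [h11, hneg]; exact h1
    simp only [Matrix.mulVec, dotProduct, Fin.sum_univ_two]
    have key : ∀ (a b : F) (d : ℝ) (t : WithTop ℝ), t ≤ val a + (d : WithTop ℝ) →
        t ≤ val b + (d : WithTop ℝ) → t ≤ val (a + b) + (d : WithTop ℝ) := by
      intro a b d t ha hb
      rcases le_total (val a) (val b) with h | h
      · exact ha.trans (by gcongr; exact le_val_add le_rfl h)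
      · exact hb.trans (by gcongr; exact le_val_add h le_rfl)
    refine le_min (key _ _ _ _ ?_ ?_) (key _ _ _ _ ?_ ?_) <;> rw [val_mul]
    · exact le_trans (by gcongr; exact min_le_left _ _) (entry_bound h1 (by linarith))
    · exact le_trans (by gcongr; exact min_le_right _ _) (entry_bound h2 (by linarith))
    · exact le_trans (by gcongr; exact min_le_left _ _) (entry_bound h3 (by linarith))
    · exact le_trans (by gcongr; exact min_le_right _ _) (entry_bound h4 (by linarith))
  · intro h
    have h0 := h ![1, 0]
    have h1 := h ![0, 1]
    simp only [Matrix.mulVec, dotProduct, Fin.sum_univ_two, Matrix.cons_val_zero,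
      Matrix.cons_val_one, mul_one, mul_zero, add_zero, zero_add, val_one, val_zero, top_add,
      min_top_right, min_top_left, le_min_iff] at h0 h1
    exact ⟨le_of_add_bound h0.1 (by linarith), le_of_add_bound h1.1 (by linarith),
      le_of_add_bound h0.2 (by linarith)⟩

theorem mem_stdMP_iff (g : Grp F) (c r : ℝ) (X : LieAlg F) :
    Ad g⁻¹ X ∈ stdMP c r ↔
      ∀ w, normOf g c w + (r : WithTop ℝ) ≤ normOf g c (X.1.mulVec w) := by
  have hg : ((g⁻¹ : Grp F) : Matrix (Fin 2) (Fin 2) F) * (g : Matrix (Fin 2) (Fin 2) F) = 1 := by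
    rw [← Matrix.SpecialLinearGroup.coe_mul, inv_mul_cancel]
    simp
  have hg' : (g : Matrix (Fin 2) (Fin 2) F) * ((g⁻¹ : Grp F) : Matrix (Fin 2) (Fin 2) F) = 1 := by
    rw [← Matrix.SpecialLinearGroup.coe_mul, mul_inv_cancel]
    simp
  have hAd : (Ad g⁻¹ X).1 =
      ((g⁻¹ : Grp F) : Matrix (Fin 2) (Fin 2) F) * X.1 * (g : Matrix (Fin 2) (Fin 2) F) := by
    simp only [Ad, LinearMap.coe_mk, AddHom.coe_mk, inv_inv]
  rw [mem_stdMP_iff_norm]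
  constructor
  · intro h w
    have := h (((g⁻¹ : Grp F) : Matrix (Fin 2) (Fin 2) F).mulVec w)
    rw [hAd, Matrix.mulVec_mulVec, Matrix.mul_assoc, hg', Matrix.mul_one,
      ← Matrix.mulVec_mulVec] at this
    exact this
  · intro h u
    have := h ((g : Matrix (Fin 2) (Fin 2) F).mulVec u)
    simp only [normOf, Matrix.mulVec_mulVec] at this
    rw [hg, Matrix.one_mulVec, ← Matrix.mul_assoc, ← hAd] at this
    exact this

/-- The Moy--Prasad filtration at `x` does not depend on the apartment used. -/
theorem point_mem_iff (g : Grp F) (c r : ℝ) (X : LieAlg F) :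
    X ∈ lieMP (point g c) r ↔ Ad g⁻¹ X ∈ stdMP c r := by
  constructor
  · rintro ⟨h, e, hp, hX⟩
    rw [mem_stdMP_iff] at hX ⊢
    have : normOf g c = normOf h e := congrArg Subtype.val hp
    rw [this]
    exact hX
  · exact fun h => ⟨g, c, rfl, h⟩

theorem lt_one_iff (a : F) : valuation F a < 1 ↔ (0 : WithTop ℝ) < val a := by
  by_cases ha : a = 0
  · simp [ha]
  · rw [← not_le, ← not_le, ← val_one (F := F), val_le_val_iff ha one_ne_zero, map_one]

theorem dual_bound (A : F) (τ : ℝ) :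
    (∀ a : F, (∃ s > -τ, (s : WithTop ℝ) ≤ val a) → valuation F (a * A) < 1) ↔
      (τ : WithTop ℝ) ≤ val A := by
  simp only [lt_one_iff, val_mul]
  by_cases hA : A = 0
  · simp [hA]
  constructor
  · intro h
    by_contra hlt
    rw [val_of_ne hA, WithTop.coe_le_coe, not_le] at hlt
    obtain ⟨a, ha, hao⟩ := exists_ord_eq (F := F) (-ord A)
    have := h a ⟨-(ord A : ℝ), by linarith, by rw [val_of_ne ha, hao]; push_cast; exact le_rfl⟩
    rw [val_of_ne ha, val_of_ne hA, hao] at this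
    norm_cast at this
    simp at this
  · rintro h a ⟨s, hs, hsa⟩
    by_cases ha : a = 0
    · simp [ha]
    rw [val_of_ne ha] at hsa ⊢
    rw [val_of_ne hA] at h ⊢
    norm_cast at hsa h ⊢
    have : (0 : ℝ) < (ord a : ℝ) + (ord A : ℝ) := by linarith
    exact_mod_cast this

/-- The filtration of the dual in coordinates. -/
theorem mem_coMP_point (g : Grp F) (c t : ℝ) (X : CoLie F) :
    X ∈ coMP (point g c) t ↔ (t : WithTop ℝ) ≤ val (X (Ad g (mk3 1 0 0))) ∧
      ((t + 2 * c : ℝ) : WithTop ℝ) ≤ val (X (Ad g (mk3 0 1 0))) ∧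
      ((t - 2 * c : ℝ) : WithTop ℝ) ≤ val (X (Ad g (mk3 0 0 1))) := by
  have hm : ∀ a b d : F, Ad g (mk3 a b d) ∈ lieMPplus (point g c) (-t) ↔
      ∃ s > -t, (s : WithTop ℝ) ≤ val a ∧ ((s - 2 * c : ℝ) : WithTop ℝ) ≤ val b ∧
        ((s + 2 * c : ℝ) : WithTop ℝ) ≤ val d := by
    intro a b d
    simp only [lieMPplus, Set.mem_iUnion, point_mem_iff, ← Ad_mul, inv_mul_cancel, Ad_one]
    simp only [stdMP, mk3, Set.mem_ofPred_eq, exists_prop]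
    simp
  have hX : ∀ a b d : F, X (Ad g (mk3 a b d)) = a * X (Ad g (mk3 1 0 0)) +
      b * X (Ad g (mk3 0 1 0)) + d * X (Ad g (mk3 0 0 1)) := by
    intro a b d
    rw [mk3_eq a b d]
    simp only [map_add, map_smul, smul_eq_mul]
  rw [← dual_bound, ← dual_bound, ← dual_bound]
  constructor
  · intro h
    refine ⟨?_, ?_, ?_⟩
    · rintro a ⟨s, hs, hsa⟩
      have := h _ ((hm a 0 0).2 ⟨s, hs, hsa, by simp, by simp⟩)
      rw [hX] at this
      simpa using this
    · rintro a ⟨s, hs, hsa⟩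
      have := h _ ((hm 0 a 0).2 ⟨s + 2 * c, by linarith, by simp, by simpa using hsa, by simp⟩)
      rw [hX] at this
      simpa using this
    · rintro a ⟨s, hs, hsa⟩
      have := h _ ((hm 0 0 a).2 ⟨s - 2 * c, by linarith, by simp, by simp, by simpa using hsa⟩)
      rw [hX] at this
      simpa using this
  · rintro ⟨h1, h2, h3⟩ Y hY
    obtain ⟨a, b, d, rfl⟩ : ∃ a b d : F, Y = Ad g (mk3 a b d) :=
      ⟨_, _, _, by rw [← eq_mk3 (Ad g⁻¹ Y), ← Ad_mul, mul_inv_cancel, Ad_one]⟩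
    obtain ⟨s, hs, ha, hb, hd⟩ := (hm a b d).1 hY
    rw [hX]
    exact Valuation.map_add_lt _ (Valuation.map_add_lt _ (h1 a ⟨s, hs, ha⟩)
      (h2 b ⟨_, by linarith, hb⟩)) (h3 d ⟨_, by linarith, hd⟩)

theorem coMP_eq (g : Grp F) (c : ℝ) {X : CoLie F} (hX : X ≠ 0) :
    ∃ d : ℝ, ∀ t : ℝ, X ∈ coMP (point g c) t ↔ t ≤ d := by
  set A := X (Ad g (mk3 1 0 0)) with hA
  set B := X (Ad g (mk3 0 1 0)) with hB
  set C := X (Ad g (mk3 0 0 1)) with hC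
  set m : WithTop ℝ := min (val A) (min (val B + ((-(2 * c) : ℝ) : WithTop ℝ))
    (val C + ((2 * c : ℝ) : WithTop ℝ))) with hm
  have hsub : ∀ (v : WithTop ℝ) (t e : ℝ), ((t + e : ℝ) : WithTop ℝ) ≤ v ↔
      (t : WithTop ℝ) ≤ v + ((-e : ℝ) : WithTop ℝ) := by
    intro v t e
    induction v using WithTop.recTopCoe with
    | top => simp
    | coe v =>
      norm_cast
      constructor <;> intro h <;> linarith
  have hmem : ∀ t : ℝ, X ∈ coMP (point g c) t ↔ (t : WithTop ℝ) ≤ m := by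
    intro t
    rw [mem_coMP_point, hm, le_min_iff, le_min_iff, ← hsub, sub_eq_add_neg, hsub _ t (-(2 * c)), neg_neg]
  have hne : m ≠ ⊤ := by
    intro htop
    have hval : ∀ a : F, val a = ⊤ → a = 0 := fun a ha => by
      by_contra h
      rw [val_of_ne h] at ha
      exact WithTop.coe_ne_top ha
    simp only [hm, min_eq_top, WithTop.add_eq_top, WithTop.coe_ne_top, or_false] at htop
    apply hX
    ext Y
    obtain ⟨a, b, d, rfl⟩ : ∃ a b d : F, Y = Ad g (mk3 a b d) :=
      ⟨_, _, _, by rw [← eq_mk3 (Ad g⁻¹ Y), ← Ad_mul, mul_inv_cancel, Ad_one]⟩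
    rw [mk3_eq a b d]
    simp only [map_add, map_smul, smul_eq_mul]
    rw [← hA, ← hB, ← hC, hval A htop.1, hval B htop.2.1, hval C htop.2.2]
    simp
  obtain ⟨d, hd⟩ := WithTop.ne_top_iff_exists.1 hne
  exact ⟨d, fun t => by rw [hmem, ← hd, WithTop.coe_le_coe]⟩

/-- The depth of a nonzero element at a point of the building exists and is unique. -/
theorem existsUnique_depthAt (x : Building F) {X : CoLie F} (hX : X ≠ 0) :
    ∃! t : ℝ, X ∈ coMP x t ∧ X ∉ coMPplus x t := by
  obtain ⟨g, c, rfl⟩ := exists_eq_point x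
  obtain ⟨d, hd⟩ := coMP_eq g c hX
  simp only [coMPplus, Set.mem_iUnion, hd]
  refine ⟨d, ⟨le_rfl, by rintro ⟨s, hs, hs'⟩; exact absurd hs' (not_le.2 hs)⟩, ?_⟩
  rintro t ⟨h1, h2⟩
  by_contra hne
  exact h2 ⟨d, lt_of_le_of_ne h1 hne, le_rfl⟩

theorem coMP_antitone (x : Building F) {s t : ℝ} (hst : s ≤ t) : coMP x t ⊆ coMP x s := by
  intro X hX Y hY
  apply hX
  simp only [lieMPplus, Set.mem_iUnion] at hY ⊢
  obtain ⟨u, hu, hY⟩ := hY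
  exact ⟨u, lt_of_le_of_lt (neg_le_neg hst) hu, hY⟩

theorem coMPExt_coe (x : Building F) (r : ℝ) : coMPExt x (r : EReal) = coMP x r := by
  ext X
  simp only [coMPExt, Set.mem_iInter, EReal.coe_le_coe_iff]
  exact ⟨fun h => h r le_rfl, fun h s hs => coMP_antitone x hs h⟩

theorem coMPExt_top (x : Building F) : coMPExt x ⊤ = {0} := by
  ext X
  simp only [coMPExt, Set.mem_iInter, Set.mem_singleton_iff]
  constructor
  · intro h
    by_contra hX
    obtain ⟨g, c, rfl⟩ := exists_eq_point x
    obtain ⟨d, hd⟩ := coMP_eq g c hX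
    have := (hd (d + 1)).1 (h _ le_top)
    linarith
  · rintro rfl s - Y -
    simp

end WellDefined

end SL2Nil

end

open Filter Topology ValuativeRel Matrix
open scoped WithZero

noncomputable section

namespace SL2Nil

/-! ### Square classes in `F` and arithmetic of the normalized valuation. -/

section Squares

variable {F : Type*} [Field F] [ValuativeRel F] [TopologicalSpace F] [IsNonarchimedeanLocalField F]

/-! The trace form identifies `𝔤*` with traceless matrices, and everything is governed by two
quantities: the invariant `disc`, which is `-4` times the determinant, and the upper right entries
of the conjugates of `Γ`. An element is nilpotent exactly when `disc` vanishes, and otherwise its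
depth is half the order of `disc`. A nonzero nilpotent orbit is that of `(0 b; 0 0)`, and replacing
`b` by `b * s ^ 2` does not change it.

Suppose the depth `t` at `x` is less than the depth `r`. If both off-diagonal entries had depth more
than `t` in an apartment through `x`, the diagonal entry would too, because its square differs from
`disc` by a product of the other two. So, up to the Weyl element, `t` is attained by the upper right
entry `b` (`exists_upperCoord_val_eq`). By Hensel's lemma, residual characteristic not `2`, every
element of the coset modulo `𝔤*_{x,t+}` has upper right entry in `b` times the nonzero squares, so
only the orbit of `(0 b; 0 0)` can be met by a nilpotent (`orbit_eq_of_mem_coset`). It is met,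
already modulo `𝔤*_{x,r}`: a change of the lower left entry alone kills `disc`
(`exists_mem_coset_of_val_upperCoord`). This gives (a) and (b).

For (c), all the sets are equal to `upperOrbits`. One inclusion is the analysis above; for the
other, a diagonal element can make any nonzero upper right entry dominate at any given point
(`exists_diagElt_dominant`). The cone follows because scaling by `ε ^ 2` and passing to a nonzero
limit both respect square classes. -/

theorem val_neg (a : F) : val (-a) = val a := by
  by_cases ha : a = 0
  · simp [ha]
  · apply le_antisymm
    · rw [val_le_val_iff (neg_ne_zero.2 ha) ha, Valuation.map_neg]
    · rw [val_le_val_iff ha (neg_ne_zero.2 ha), Valuation.map_neg]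

theorem val_eq_zero_of_valuation_eq_one {a : F} (ha : valuation F a = 1) : val a = 0 := by
  have h0 : a ≠ 0 := by
    rintro rfl
    simp at ha
  rw [← val_one (F := F)]
  apply le_antisymm
  · rw [val_le_val_iff h0 one_ne_zero, ha, map_one]
  · rw [val_le_val_iff one_ne_zero h0, ha, map_one]

theorem residue_two_ne_zero (hp : ringChar 𝓀[F] ≠ 2) : (2 : 𝓀[F]) ≠ 0 :=
  Ring.two_ne_zero hp

theorem isUnit_two_integer (hp : ringChar 𝓀[F] ≠ 2) : IsUnit (2 : 𝒪[F]) := by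
  have h := residue_two_ne_zero hp
  rw [← map_ofNat (IsLocalRing.residue 𝒪[F])] at h
  exact (IsLocalRing.residue_ne_zero_iff_isUnit _).1 h

theorem valuation_two (hp : ringChar 𝓀[F] ≠ 2) : valuation F (2 : F) = 1 := by
  have h := (Valuation.integer.integers (valuation F)).isUnit_iff_valuation_eq_one.1
    (isUnit_two_integer hp)
  rwa [map_ofNat] at h

theorem two_ne_zero_of_residue (hp : ringChar 𝓀[F] ≠ 2) : (2 : F) ≠ 0 := by
  intro h
  have := valuation_two hp
  simp [h] at this

theorem val_two (hp : ringChar 𝓀[F] ≠ 2) : val (2 : F) = 0 :=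
  val_eq_zero_of_valuation_eq_one (valuation_two hp)

theorem val_four (hp : ringChar 𝓀[F] ≠ 2) : val (4 : F) = 0 := by
  rw [show (4 : F) = 2 * 2 by norm_num, val_mul, val_two hp, add_zero]

/-- An element congruent to `1` modulo the maximal ideal is a square. -/
theorem exists_sq_eq_of_val_sub_one_pos (hp : ringChar 𝓀[F] ≠ 2) {u : F}
    (hu : valuation F (u - 1) < 1) : ∃ s : F, s ^ 2 = u := by
  let := IsTopologicalAddGroup.rightUniformSpace F
  have := isUniformAddGroup_of_addCommGroup (G := F)
  have hu1 : valuation F u ≤ 1 := by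
    have h := (valuation F).map_add (u - 1) 1
    rw [sub_add_cancel, map_one] at h
    exact h.trans (max_le hu.le le_rfl)
  let u' : 𝒪[F] := ⟨u, hu1⟩
  have hmem : u' - 1 ∈ 𝓂[F] := by
    rw [IsLocalRing.mem_maximalIdeal, mem_nonunits_iff,
      (Valuation.integer.integers (valuation F)).isUnit_iff_valuation_eq_one]
    exact ne_of_lt hu
  -- Hensel's lemma for `T ^ 2 - u` at the approximate root `1`, where the derivative `2` is a unit.
  obtain ⟨s, hs, -⟩ := HenselianRing.is_henselian (I := 𝓂[F])
    (Polynomial.X ^ 2 - Polynomial.C u') (Polynomial.monic_X_pow_sub_C u' two_ne_zero) 1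
    (by
      rw [← neg_mem_iff] at hmem
      simpa using hmem)
    (by
      simp only [Polynomial.derivative_sub, Polynomial.derivative_X_pow, Polynomial.derivative_C]
      simpa [one_add_one_eq_two] using (isUnit_two_integer hp).map (Ideal.Quotient.mk 𝓂[F]))
  refine ⟨s, ?_⟩
  simp only [Polynomial.IsRoot.def, Polynomial.eval_sub, Polynomial.eval_pow, Polynomial.eval_X,
    Polynomial.eval_C, sub_eq_zero] at hs
  exact congrArg Subtype.val hs

/-- Elements close to `b ≠ 0` lie in its square class. -/
theorem exists_eq_mul_sq (hp : ringChar 𝓀[F] ≠ 2) {a b : F}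
    (h : valuation F (a - b) < valuation F b) : ∃ s : F, s ≠ 0 ∧ a = b * s ^ 2 := by
  have hb : b ≠ 0 := by
    rintro rfl
    simp at h
  have hv : 0 < valuation F b := by simpa [zero_lt_iff] using hb
  obtain ⟨s, hs⟩ := exists_sq_eq_of_val_sub_one_pos hp (u := a / b) (by
    rw [show a / b - 1 = (a - b) / b by field_simp, map_div₀]
    exact (div_lt_one₀ hv).2 h)
  have hab : a = b * s ^ 2 := by
    rw [hs]
    field_simp
  refine ⟨s, ?_, hab⟩
  rintro rfl
  rw [hab] at h
  simp at h

/-- Square classes of nonzero elements are open; this is what controls limits in the cone. -/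
theorem eventually_eq_mul_sq (hp : ringChar 𝓀[F] ≠ 2) {b : F} (hb : b ≠ 0) :
    ∀ᶠ a in 𝓝 b, ∃ s : F, s ≠ 0 ∧ a = b * s ^ 2 := by
  filter_upwards [(IsValuativeTopology.hasBasis_nhds' b).mem_of_mem
    (i := valuation F b) (by simpa using hb)] with a ha
  exact exists_eq_mul_sq hp ha

theorem le_val_iff_of_ne {a : F} (ha : a ≠ 0) (t : ℝ) :
    (t : WithTop ℝ) ≤ val a ↔ t ≤ (ord a : ℝ) := by
  rw [val_of_ne ha, WithTop.coe_le_coe]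

theorem valuation_lt_of_val_lt {a b : F} (h : val b < val a) : valuation F a < valuation F b := by
  have hb : b ≠ 0 := by
    rintro rfl
    simp at h
  by_cases ha : a = 0
  · simpa [ha, zero_lt_iff] using hb
  · rw [← not_le] at h ⊢
    rwa [val_le_val_iff ha hb] at h

theorem exists_le_val (a : F) : ∃ t : ℝ, (t : WithTop ℝ) ≤ val a := by
  by_cases ha : a = 0
  · exact ⟨0, by simp [ha]⟩
  · exact ⟨ord a, by rw [le_val_iff_of_ne ha]⟩

theorem ord_inv {a : F} (ha : a ≠ 0) : ord a⁻¹ = -ord a := by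
  have h := ord_mul ha (inv_ne_zero ha)
  rw [mul_inv_cancel₀ ha] at h
  have h1 : ord (1 : F) = 0 := by simp [ord]
  omega

theorem add_le_val_mul {s t : ℝ} {a b : F} (ha : (s : WithTop ℝ) ≤ val a)
    (hb : (t : WithTop ℝ) ≤ val b) : ((s + t : ℝ) : WithTop ℝ) ≤ val (a * b) := by
  rw [val_mul, WithTop.coe_add]
  exact add_le_add ha hb

end Squares

/-! ### Matrix coordinates on the dual, the discriminant, and nilpotent representatives. -/

section Coordinates

variable {F : Type*} [Field F]

/-- The value at `diag(1,-1)`: twice the upper left entry of the matrix which represents `X` by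
the trace form. -/
def diagCoord (X : CoLie F) : F := X (mk3 1 0 0)

/-- The upper right entry of the matrix which represents `X` by the trace form. -/
def upperCoord (X : CoLie F) : F := X (mk3 0 0 1)

/-- The lower left entry of the matrix which represents `X` by the trace form. -/
def lowerCoord (X : CoLie F) : F := X (mk3 0 1 0)

/-- `-4` times the determinant of the matrix which represents `X` by the trace form. -/
def disc (X : CoLie F) : F := diagCoord X ^ 2 + 4 * upperCoord X * lowerCoord X

theorem apply_mk3 (X : CoLie F) (a b c : F) :
    X (mk3 a b c) = a * diagCoord X + b * lowerCoord X + c * upperCoord X := by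
  rw [mk3_eq a b c]
  simp only [map_add, map_smul, smul_eq_mul, diagCoord, lowerCoord, upperCoord]

theorem coLie_ext {X Y : CoLie F} (hd : diagCoord X = diagCoord Y)
    (hu : upperCoord X = upperCoord Y) (hl : lowerCoord X = lowerCoord Y) : X = Y := by
  ext Z
  rw [eq_mk3 Z, apply_mk3, apply_mk3, hd, hu, hl]

/-- The functional with given coordinates. -/
def ofCoords (a b c : F) : CoLie F where
  toFun X := a * X.1 0 0 + b * X.1 1 0 + c * X.1 0 1
  map_add' X Y := by
    have h : (X + Y).1 = X.1 + Y.1 := rfl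
    simp only [h, Matrix.add_apply]
    ring
  map_smul' t X := by
    have h : (t • X).1 = t • X.1 := rfl
    simp only [h, Matrix.smul_apply, smul_eq_mul, RingHom.id_apply]
    ring

@[simp] theorem diagCoord_ofCoords (a b c : F) : diagCoord (ofCoords a b c) = a := by
  simp [diagCoord, ofCoords, mk3]

@[simp] theorem upperCoord_ofCoords (a b c : F) : upperCoord (ofCoords a b c) = b := by
  simp [upperCoord, ofCoords, mk3]

@[simp] theorem lowerCoord_ofCoords (a b c : F) : lowerCoord (ofCoords a b c) = c := by
  simp [lowerCoord, ofCoords, mk3]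

@[simp] theorem diagCoord_add (X Y : CoLie F) :
    diagCoord (X + Y) = diagCoord X + diagCoord Y := rfl

@[simp] theorem upperCoord_add (X Y : CoLie F) :
    upperCoord (X + Y) = upperCoord X + upperCoord Y := rfl

@[simp] theorem lowerCoord_add (X Y : CoLie F) :
    lowerCoord (X + Y) = lowerCoord X + lowerCoord Y := rfl

@[simp] theorem diagCoord_zero : diagCoord (0 : CoLie F) = 0 := rfl

@[simp] theorem upperCoord_zero : upperCoord (0 : CoLie F) = 0 := rfl

@[simp] theorem lowerCoord_zero : lowerCoord (0 : CoLie F) = 0 := rfl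

@[simp] theorem diagCoord_smul (a : F) (X : CoLie F) :
    diagCoord (a • X) = a * diagCoord X := rfl

@[simp] theorem lowerCoord_smul (a : F) (X : CoLie F) :
    lowerCoord (a • X) = a * lowerCoord X := rfl

@[simp] theorem upperCoord_smul (a : F) (X : CoLie F) :
    upperCoord (a • X) = a * upperCoord X := rfl

/-- All formulas for the coadjoint action in coordinates are read off from this one. -/
theorem Ad_inv_mk3 (g : Grp F) (x y z : F) :
    Ad g⁻¹ (mk3 x y z) =
      mk3 (x * (g.1 0 0 * g.1 1 1 + g.1 0 1 * g.1 1 0) + y * (g.1 1 0 * g.1 1 1)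
          - z * (g.1 0 0 * g.1 0 1))
        (2 * x * (g.1 0 1 * g.1 1 1) + y * g.1 1 1 ^ 2 - z * g.1 0 1 ^ 2)
        (-(2 * x * (g.1 0 0 * g.1 1 0)) - y * g.1 1 0 ^ 2 + z * g.1 0 0 ^ 2) := by
  apply Subtype.ext
  simp only [Ad, LinearMap.coe_mk, AddHom.coe_mk, inv_inv, Matrix.SpecialLinearGroup.coe_inv,
    Matrix.adjugate_fin_two, mk3]
  ext i j
  fin_cases i <;> fin_cases j <;>
    simp [Matrix.mul_apply, Fin.sum_univ_two] <;> ring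

theorem diagCoord_coAd (g : Grp F) (X : CoLie F) :
    diagCoord (coAd g X) = (g.1 0 0 * g.1 1 1 + g.1 0 1 * g.1 1 0) * diagCoord X
      + 2 * (g.1 0 1 * g.1 1 1) * lowerCoord X - 2 * (g.1 0 0 * g.1 1 0) * upperCoord X := by
  rw [diagCoord, coAd, LinearMap.comp_apply, Ad_inv_mk3, apply_mk3]
  ring

theorem upperCoord_coAd (g : Grp F) (X : CoLie F) :
    upperCoord (coAd g X) = -(g.1 0 0 * g.1 0 1) * diagCoord X
      - g.1 0 1 ^ 2 * lowerCoord X + g.1 0 0 ^ 2 * upperCoord X := by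
  rw [upperCoord, coAd, LinearMap.comp_apply, Ad_inv_mk3, apply_mk3]
  ring

theorem lowerCoord_coAd (g : Grp F) (X : CoLie F) :
    lowerCoord (coAd g X) = g.1 1 0 * g.1 1 1 * diagCoord X
      + g.1 1 1 ^ 2 * lowerCoord X - g.1 1 0 ^ 2 * upperCoord X := by
  rw [lowerCoord, coAd, LinearMap.comp_apply, Ad_inv_mk3, apply_mk3]
  ring

theorem det_entries (g : Grp F) : g.1 0 0 * g.1 1 1 - g.1 0 1 * g.1 1 0 = 1 := by
  rw [← Matrix.det_fin_two, g.2]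

@[simp] theorem disc_coAd (g : Grp F) (X : CoLie F) : disc (coAd g X) = disc X := by
  have h : disc (coAd g X) =
      (g.1 0 0 * g.1 1 1 - g.1 0 1 * g.1 1 0) ^ 2 * disc X := by
    simp only [disc, diagCoord_coAd, upperCoord_coAd, lowerCoord_coAd]
    ring
  rw [h, det_entries]
  ring

theorem coAd_mul (g h : Grp F) (X : CoLie F) : coAd (g * h) X = coAd g (coAd h X) := by
  ext Y
  simp only [coAd, LinearMap.comp_apply, _root_.mul_inv_rev, Ad_mul]

@[simp] theorem coAd_one (X : CoLie F) : coAd 1 X = X := by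
  ext Y
  simp only [coAd, LinearMap.comp_apply, inv_one, Ad_one]

@[simp] theorem coAd_inv_coAd (g : Grp F) (X : CoLie F) : coAd g⁻¹ (coAd g X) = X := by
  rw [← coAd_mul, inv_mul_cancel, coAd_one]

@[simp] theorem coAd_coAd_inv (g : Grp F) (X : CoLie F) : coAd g (coAd g⁻¹ X) = X := by
  rw [← coAd_mul, mul_inv_cancel, coAd_one]

theorem coAd_add (g : Grp F) (X Y : CoLie F) : coAd g (X + Y) = coAd g X + coAd g Y := rfl

theorem coAd_ne_zero (g : Grp F) {X : CoLie F} (hX : X ≠ 0) : coAd g X ≠ 0 := by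
  intro h
  apply hX
  rw [← coAd_inv_coAd g X, h]
  rfl

theorem orbit_coAd (g : Grp F) (X : CoLie F) : orbit (coAd g X) = orbit X := by
  ext Y
  constructor
  · rintro ⟨h, rfl⟩
    exact ⟨h * g, coAd_mul h g X⟩
  · rintro ⟨h, rfl⟩
    exact ⟨h * g⁻¹, by
      change coAd (h * g⁻¹) (coAd g X) = coAd h X
      rw [← coAd_mul, inv_mul_cancel_right]⟩

theorem mem_orbit_self (X : CoLie F) : X ∈ orbit X := ⟨1, coAd_one X⟩

theorem orbit_eq_of_mem {X Y : CoLie F} (h : Y ∈ orbit X) : orbit X = orbit Y := by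
  obtain ⟨g, rfl⟩ := h
  exact (orbit_coAd g X).symm

/-- The Weyl element `(0 1; -1 0)`. -/
def weyl : Grp F := ⟨!![0, 1; -1, 0], by simp [Matrix.det_fin_two]⟩

/-- The lower unipotent element with parameter `u`. -/
def lowerUnip (u : F) : Grp F := ⟨!![1, 0; u, 1], by simp [Matrix.det_fin_two]⟩

/-- The upper unipotent element `(1 1; 0 1)`. -/
def upperUnip : Grp F := ⟨!![1, 1; 0, 1], by simp [Matrix.det_fin_two]⟩

/-- The diagonal element `diag(s, s⁻¹)`. -/
def diagElt (s : Fˣ) : Grp F :=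
  ⟨!![(s : F), 0; 0, ((s⁻¹ : Fˣ) : F)], by simp [Matrix.det_fin_two]⟩

theorem coe_diagElt (s : Fˣ) : ((diagElt s : Grp F) : Matrix (Fin 2) (Fin 2) F) =
    !![(s : F), 0; 0, ((s⁻¹ : Fˣ) : F)] := rfl

@[simp] theorem upperCoord_weyl (X : CoLie F) : upperCoord (coAd weyl X) = -lowerCoord X := by
  rw [upperCoord_coAd]
  simp [weyl]

@[simp] theorem diagCoord_lowerUnip (u : F) (X : CoLie F) :
    diagCoord (coAd (lowerUnip u) X) = diagCoord X - 2 * u * upperCoord X := by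
  rw [diagCoord_coAd]
  simp [lowerUnip]

@[simp] theorem upperCoord_lowerUnip (u : F) (X : CoLie F) :
    upperCoord (coAd (lowerUnip u) X) = upperCoord X := by
  rw [upperCoord_coAd]
  simp [lowerUnip]

@[simp] theorem diagCoord_diagElt (s : Fˣ) (X : CoLie F) :
    diagCoord (coAd (diagElt s) X) = diagCoord X := by
  rw [diagCoord_coAd]
  simp [diagElt]

@[simp] theorem upperCoord_diagElt (s : Fˣ) (X : CoLie F) :
    upperCoord (coAd (diagElt s) X) = (s : F) ^ 2 * upperCoord X := by
  rw [upperCoord_coAd]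
  simp [diagElt]

@[simp] theorem lowerCoord_diagElt (s : Fˣ) (X : CoLie F) :
    lowerCoord (coAd (diagElt s) X) = ((s : F)⁻¹) ^ 2 * lowerCoord X := by
  rw [lowerCoord_coAd]
  simp [diagElt]

/-- The nilpotent functional represented by `(0 b; 0 0)`. -/
def nilRep (b : F) : CoLie F := ofCoords 0 b 0

theorem disc_nilRep (b : F) : disc (nilRep b) = 0 := by simp [disc, nilRep]

/-- Every element with nonzero upper right entry is conjugate to an antidiagonal one with the same
upper right entry. -/
theorem exists_coAd_antidiagonal (h2 : (2 : F) ≠ 0) {X : CoLie F} (hX : upperCoord X ≠ 0) :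
    ∃ g : Grp F, diagCoord (coAd g X) = 0 ∧ upperCoord (coAd g X) = upperCoord X := by
  refine ⟨lowerUnip (diagCoord X / (2 * upperCoord X)), ?_, by simp⟩
  rw [diagCoord_lowerUnip]
  field_simp
  ring

/-- Once the diagonal entry is conjugated away, `disc` is four times the product of the off-diagonal
entries, so the lower one must vanish. -/
theorem orbit_eq_orbit_nilRep (h2 : (2 : F) ≠ 0) {X : CoLie F} (hd : disc X = 0)
    (hX : upperCoord X ≠ 0) : orbit X = orbit (nilRep (upperCoord X)) := by
  obtain ⟨g, h0, hu⟩ := exists_coAd_antidiagonal h2 hX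
  rw [← orbit_coAd g X]
  congr 1
  have h4 : (4 : F) ≠ 0 := by
    rw [show (4 : F) = 2 * 2 by norm_num]
    exact mul_ne_zero h2 h2
  rw [← disc_coAd g X, disc, h0, hu] at hd
  have hl : lowerCoord (coAd g X) = 0 := by simpa [h4, hX] using hd
  apply coLie_ext <;> simp [nilRep, h0, hu, hl]

/-- Conjugation by `diag(s, s⁻¹)` multiplies the upper right entry by `s ^ 2`. -/
theorem orbit_nilRep_mul_sq (b : F) {s : F} (hs : s ≠ 0) :
    orbit (nilRep (b * s ^ 2)) = orbit (nilRep b) := by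
  rw [← orbit_coAd (diagElt (Units.mk0 s hs)) (nilRep b)]
  congr 1
  apply coLie_ext <;> simp [nilRep]
  ring

/-- The Weyl element brings up a nonzero lower entry; if only the diagonal coordinate survives, an
upper unipotent moves it, up to sign, to the upper right. -/
theorem exists_upperCoord_ne_zero {X : CoLie F} (hX : X ≠ 0) :
    ∃ g : Grp F, upperCoord (coAd g X) ≠ 0 := by
  by_cases hu : upperCoord X = 0
  · by_cases hl : lowerCoord X = 0
    · refine ⟨upperUnip, ?_⟩
      rw [upperCoord_coAd]
      intro hd
      simp only [upperUnip, hu, hl] at hd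
      apply hX
      apply coLie_ext
      · simpa [diagCoord] using hd
      · exact hu
      · exact hl
    · exact ⟨weyl, by simpa using hl⟩
  · exact ⟨1, by simpa using hu⟩

theorem exists_coAd_eq_nilRep (h2 : (2 : F) ≠ 0) {X : CoLie F} (hX : X ≠ 0) (hd : disc X = 0) :
    ∃ (g : Grp F) (b : F), X = coAd g (nilRep b) := by
  obtain ⟨g, hg⟩ := exists_upperCoord_ne_zero hX
  have h := orbit_eq_orbit_nilRep h2 (by rwa [disc_coAd]) hg
  rw [orbit_coAd] at h
  obtain ⟨k, hk⟩ : X ∈ orbit (nilRep (upperCoord (coAd g X))) := h ▸ mem_orbit_self X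
  exact ⟨k, _, hk.symm⟩

/-- The orbits of the nilpotent elements `(0 b; 0 0)` for the nonzero upper right entries `b` of
the conjugates of `X`. -/
def upperOrbits (X : CoLie F) : Set (Set (CoLie F)) :=
  {O | ∃ g : Grp F, upperCoord (coAd g X) ≠ 0 ∧ O = orbit (nilRep (upperCoord (coAd g X)))}

theorem upperOrbits_coAd (g : Grp F) (X : CoLie F) : upperOrbits (coAd g X) = upperOrbits X := by
  ext O
  constructor
  · rintro ⟨k, hk⟩
    exact ⟨k * g, by rwa [coAd_mul]⟩
  · rintro ⟨k, hk⟩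
    exact ⟨k * g⁻¹, by rwa [← coAd_mul, inv_mul_cancel_right]⟩

end Coordinates

/-! ### Continuity of the coordinates and of the discriminant. -/

section Continuity

variable {F : Type*} [Field F] [TopologicalSpace F]

theorem continuous_eval (Y : LieAlg F) : Continuous fun X : CoLie F => X Y :=
  (continuous_apply Y).comp continuous_induced_dom

theorem continuous_upperCoord : Continuous (upperCoord : CoLie F → F) := continuous_eval _

theorem continuous_disc [IsTopologicalRing F] : Continuous (disc : CoLie F → F) :=
  ((continuous_eval _).pow 2).add
    ((continuous_const.mul (continuous_eval _)).mul (continuous_eval _))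

end Continuity

/-! ### Conjugates of the diagonal torus as one-parameter subgroups. -/

section DiagonalTorus

variable {F : Type*} [Field F]

/-- The homomorphism from the multiplicative group onto the diagonal torus. -/
def diagHom : Fˣ →* Grp F where
  toFun := diagElt
  map_one' := by
    apply Subtype.ext
    ext i j
    fin_cases i <;> fin_cases j <;> simp [diagElt]
  map_mul' s t := by
    apply Subtype.ext
    ext i j
    fin_cases i <;> fin_cases j <;>
      simp [coe_diagElt, Matrix.SpecialLinearGroup.coe_mul, mul_comm]

theorem isOneParam_conj_diagHom (g : Grp F) :
    IsOneParam ((MulAut.conj g).toMonoidHom.comp (diagHom (F := F))) := by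
  refine ⟨fun i j => LaurentPolynomial.C (g.1 i 0 * (g⁻¹).1 0 j) * LaurentPolynomial.T 1 +
    LaurentPolynomial.C (g.1 i 1 * (g⁻¹).1 1 j) * LaurentPolynomial.T (-1), ?_⟩
  intro t i j
  change ((g * diagElt t * g⁻¹ : Grp F) : Matrix (Fin 2) (Fin 2) F) i j = _
  simp only [Matrix.SpecialLinearGroup.coe_mul, Matrix.mul_apply, Fin.sum_univ_two, coe_diagElt]
  simp
  ring

end DiagonalTorus

/-! ### Nilpotency is the vanishing of the discriminant. -/

section Nilpotent

variable {F : Type*} [Field F] [ValuativeRel F] [TopologicalSpace F] [IsNonarchimedeanLocalField F]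

/-- The valuation is not trivial, so nonzero elements accumulate at `0`; otherwise the limit that
defines nilpotency would be vacuous. -/
instance neBot_comap_units_nhds_zero : (comap (fun t : Fˣ => (t : F)) (𝓝 0)).NeBot := by
  rw [comap_neBot_iff]
  intro s hs
  obtain ⟨γ, hγ, hs⟩ := (IsValuativeTopology.hasBasis_nhds_zero' F).mem_iff.1 hs
  obtain ⟨c, rfl⟩ := ValuativeRel.valuation_surjective γ
  have hc : c ≠ 0 := by simpa using hγ
  obtain ⟨a, ha, hac⟩ := exists_ord_eq (F := F) (ord c + 1)
  refine ⟨Units.mk0 a ha, hs ?_⟩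
  apply valuation_lt_of_val_lt
  rw [Units.val_mk0, val_of_ne hc, val_of_ne ha, hac]
  norm_cast
  omega

/-- Along `φ(t) · X` the discriminant is constant by invariance and tends to `0` by continuity. -/
theorem disc_eq_zero_of_isNilp {X : CoLie F} (hX : IsNilp X) : disc X = 0 := by
  obtain ⟨φ, -, h⟩ := hX
  have h1 := (continuous_disc.tendsto (0 : CoLie F)).comp h
  have h2 : disc (0 : CoLie F) = 0 := by simp [disc]
  simp only [Function.comp_def, disc_coAd, h2] at h1
  by_contra hd
  obtain ⟨-, h3⟩ := (h1.eventually ((IsValuativeTopology.hasBasis_nhds_zero' F).mem_of_mem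
    (i := valuation F (disc X)) (by simpa using hd))).exists
  exact lt_irrefl _ h3

theorem isNilp_of_disc_eq_zero (h2 : (2 : F) ≠ 0) {X : CoLie F} (hd : disc X = 0) :
    IsNilp X := by
  obtain ⟨g, b, rfl⟩ : ∃ (g : Grp F) (b : F), X = coAd g (nilRep b) := by
    by_cases hX : X = 0
    · refine ⟨1, 0, ?_⟩
      rw [coAd_one, hX]
      apply coLie_ext <;> simp [nilRep]
    · exact exists_coAd_eq_nilRep h2 hX hd
  refine ⟨_, isOneParam_conj_diagHom g, ?_⟩
  -- The torus conjugated by the same `g` scales the element by `t ^ 2`.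
  have hφ : ∀ t : Fˣ, coAd (((MulAut.conj g).toMonoidHom.comp diagHom) t) (coAd g (nilRep b)) =
      coAd g ((t : F) ^ 2 • nilRep b) := by
    intro t
    change coAd (g * diagElt t * g⁻¹) _ = _
    rw [← coAd_mul, inv_mul_cancel_right, coAd_mul]
    congr 1
    apply coLie_ext
    · simp [nilRep]
    · simp
    · simp [nilRep]
  simp only [hφ]
  rw [nhds_induced, tendsto_comap_iff, tendsto_pi_nhds]
  intro Y
  change Tendsto (fun t : Fˣ => (t : F) ^ 2 * nilRep b (Ad g⁻¹ Y)) _ (𝓝 0)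
  have h0 : Tendsto (fun t : Fˣ => (t : F)) (comap (fun t : Fˣ => (t : F)) (𝓝 0)) (𝓝 0) :=
    tendsto_comap
  simpa using (h0.pow 2).mul_const (nilRep b (Ad g⁻¹ Y))

theorem isNilp_iff (h2 : (2 : F) ≠ 0) (X : CoLie F) : IsNilp X ↔ disc X = 0 :=
  ⟨disc_eq_zero_of_isNilp, isNilp_of_disc_eq_zero h2⟩

end Nilpotent

/-! ### The depth is half the order of the discriminant. -/

section Depth

variable {F : Type*} [Field F] [ValuativeRel F] [TopologicalSpace F] [IsNonarchimedeanLocalField F]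

theorem mem_coMP_iff (h : Grp F) (c t : ℝ) (X : CoLie F) :
    X ∈ coMP (point h c) t ↔ (t : WithTop ℝ) ≤ val (diagCoord (coAd h⁻¹ X)) ∧
      ((t + 2 * c : ℝ) : WithTop ℝ) ≤ val (lowerCoord (coAd h⁻¹ X)) ∧
      ((t - 2 * c : ℝ) : WithTop ℝ) ≤ val (upperCoord (coAd h⁻¹ X)) := by
  rw [mem_coMP_point]
  simp only [diagCoord, lowerCoord, upperCoord, coAd, LinearMap.comp_apply, inv_inv]

theorem mem_coMP_depthAt (x : Building F) {X : CoLie F} (hX : X ≠ 0) :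
    X ∈ coMP x (depthAt x X) ∧ X ∉ coMPplus x (depthAt x X) :=
  Classical.epsilon_spec (existsUnique_depthAt x hX).exists

theorem depthAt_eq {x : Building F} {X : CoLie F} (hX : X ≠ 0) {t : ℝ} (h : X ∈ coMP x t)
    (h' : X ∉ coMPplus x t) : depthAt x X = t :=
  (existsUnique_depthAt x hX).unique (mem_coMP_depthAt x hX) ⟨h, h'⟩

theorem le_depthAt {x : Building F} {X : CoLie F} (hX : X ≠ 0) {t : ℝ} (h : X ∈ coMP x t) :
    t ≤ depthAt x X := by
  by_contra! hlt
  exact (mem_coMP_depthAt x hX).2 (Set.mem_biUnion hlt h)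

theorem add_le_val_four_mul_mul (hp : ringChar 𝓀[F] ≠ 2) {s t : ℝ} {a b : F}
    (ha : (s : WithTop ℝ) ≤ val a) (hb : (t : WithTop ℝ) ≤ val b) :
    ((s + t : ℝ) : WithTop ℝ) ≤ val (4 * a * b) := by
  rw [mul_assoc, val_mul, val_four hp, zero_add]
  exact add_le_val_mul ha hb

/-- The shifts `2 * c` and `-2 * c` of the off-diagonal entries cancel in their product, leaving a
bound independent of the point. -/
theorem le_val_disc_of_mem_coMP (hp : ringChar 𝓀[F] ≠ 2) {x : Building F} {X : CoLie F} {t : ℝ}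
    (h : X ∈ coMP x t) : ((2 * t : ℝ) : WithTop ℝ) ≤ val (disc X) := by
  obtain ⟨k, c, rfl⟩ := exists_eq_point x
  rw [mem_coMP_iff] at h
  rw [← disc_coAd k⁻¹ X]
  apply le_val_add
  · rw [pow_two, two_mul]
    exact add_le_val_mul h.1 h.1
  · rw [show 2 * t = (t - 2 * c) + (t + 2 * c) by ring]
    exact add_le_val_four_mul_mul hp h.2.2 h.2.1

theorem exists_mem_coMP_half_ord_disc (hp : ringChar 𝓀[F] ≠ 2) {X : CoLie F}
    (hd : disc X ≠ 0) : ∃ x : Building F, X ∈ coMP x ((ord (disc X) : ℝ) / 2) := by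
  have h2 := two_ne_zero_of_residue hp
  have hX : X ≠ 0 := by
    rintro rfl
    exact hd (by simp [disc])
  obtain ⟨g, hg⟩ := exists_upperCoord_ne_zero hX
  obtain ⟨k, h0, hk⟩ := exists_coAd_antidiagonal h2 hg
  rw [← coAd_mul] at h0 hk
  rw [← hk] at hg
  generalize k * g = m at *
  have hdisc : disc X = 4 * (upperCoord (coAd m X) * lowerCoord (coAd m X)) := by
    rw [← disc_coAd m X, disc, h0]
    ring
  have hl : lowerCoord (coAd m X) ≠ 0 := by
    intro h
    simp [hdisc, h] at hd
  have hval := congrArg val hdisc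
  rw [val_mul, val_four hp, zero_add, val_of_ne hd, val_of_ne (mul_ne_zero hg hl),
    ord_mul hg hl, WithTop.coe_eq_coe] at hval
  push_cast at hval
  -- For the antidiagonal conjugate, this position gives both off-diagonal entries the same depth,
  -- half of the order of their product.
  refine ⟨point m⁻¹ (((ord (disc X) : ℝ) / 2 - ord (upperCoord (coAd m X))) / 2), ?_⟩
  rw [mem_coMP_iff, inv_inv, h0, le_val_iff_of_ne hg, le_val_iff_of_ne hl, hval]
  refine ⟨by simp, ?_, ?_⟩ <;> linarith

theorem depth_of_disc_ne_zero (hp : ringChar 𝓀[F] ≠ 2) {X : CoLie F} (hd : disc X ≠ 0) :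
    depth X = (((ord (disc X) : ℝ) / 2 : ℝ) : EReal) := by
  have hX : X ≠ 0 := by
    rintro rfl
    exact hd (by simp [disc])
  rw [depth, if_neg (by rwa [isNilp_iff (two_ne_zero_of_residue hp)])]
  apply le_antisymm
  · refine iSup_le fun x => ?_
    have h := le_val_disc_of_mem_coMP hp (mem_coMP_depthAt x hX).1
    rw [le_val_iff_of_ne hd] at h
    rw [EReal.coe_le_coe_iff]
    linarith
  · obtain ⟨x, hx⟩ := exists_mem_coMP_half_ord_disc hp hd
    exact le_iSup_of_le x (EReal.coe_le_coe_iff.2 (le_depthAt hX hx))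

theorem depth_of_disc_eq_zero (hp : ringChar 𝓀[F] ≠ 2) {X : CoLie F} (hd : disc X = 0) :
    depth X = ⊤ := by
  rw [depth, if_pos ((isNilp_iff (two_ne_zero_of_residue hp) X).2 hd)]

/-- Since `val 0 = ⊤`, this form treats nilpotent elements, of infinite depth, together with the
others. -/
theorem coe_le_depth_iff (hp : ringChar 𝓀[F] ≠ 2) (X : CoLie F) (s : ℝ) :
    (s : EReal) ≤ depth X ↔ ((2 * s : ℝ) : WithTop ℝ) ≤ val (disc X) := by
  by_cases hd : disc X = 0
  · simp [depth_of_disc_eq_zero hp hd, hd]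
  · rw [depth_of_disc_ne_zero hp hd, EReal.coe_le_coe_iff, le_val_iff_of_ne hd,
      le_div_iff₀' two_pos]

theorem coe_lt_depth_iff (hp : ringChar 𝓀[F] ≠ 2) (X : CoLie F) (s : ℝ) :
    (s : EReal) < depth X ↔ ((2 * s : ℝ) : WithTop ℝ) < val (disc X) := by
  by_cases hd : disc X = 0
  · rw [depth_of_disc_eq_zero hp hd, hd, val_zero]
    simp only [EReal.coe_lt_top, WithTop.coe_lt_top]
  · rw [depth_of_disc_ne_zero hp hd, EReal.coe_lt_coe_iff, val_of_ne hd, WithTop.coe_lt_coe,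
      lt_div_iff₀' two_pos]

theorem depth_coAd (hp : ringChar 𝓀[F] ≠ 2) (g : Grp F) (X : CoLie F) :
    depth (coAd g X) = depth X := by
  by_cases hd : disc X = 0
  · rw [depth_of_disc_eq_zero hp hd, depth_of_disc_eq_zero hp (by rwa [disc_coAd])]
  · rw [depth_of_disc_ne_zero hp hd, depth_of_disc_ne_zero hp (by rwa [disc_coAd]), disc_coAd]

end Depth

/-! ### The dominant entry in an adapted apartment, and the orbit at a point. -/

section Frame

variable {F : Type*} [Field F] [ValuativeRel F] [TopologicalSpace F] [IsNonarchimedeanLocalField F]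

/-- The point `point h c` lies in the apartment of `h` in two ways, exchanged by the Weyl
element. -/
theorem point_mul_weyl_inv (h : Grp F) (c : ℝ) : point (h * weyl⁻¹) (-c) = point h c := by
  apply Subtype.ext
  funext w
  change normOf _ _ w = normOf _ _ w
  have hw : ((h * weyl⁻¹)⁻¹ : Grp F).1.mulVec w = (weyl : Grp F).1.mulVec (h⁻¹.1.mulVec w) := by
    rw [_root_.mul_inv_rev, inv_inv, Matrix.mulVec_mulVec, Matrix.SpecialLinearGroup.coe_mul]
  have h0 : ∀ u : Fin 2 → F, (weyl : Grp F).1.mulVec u 0 = u 1 := fun u => by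
    simp [weyl, Matrix.mulVec, dotProduct, Fin.sum_univ_two]
  have h1 : ∀ u : Fin 2 → F, (weyl : Grp F).1.mulVec u 1 = -u 0 := fun u => by
    simp [weyl, Matrix.mulVec, dotProduct, Fin.sum_univ_two]
  rw [normOf, normOf, hw, h0, h1, val_neg, neg_neg, min_comm]

theorem exists_pos_add_le {t : ℝ} {v : WithTop ℝ} (h : (t : WithTop ℝ) < v) :
    ∃ δ > 0, ((t + δ : ℝ) : WithTop ℝ) ≤ v := by
  induction v using WithTop.recTopCoe with
  | top => exact ⟨1, one_pos, le_top⟩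
  | coe v =>
    rw [WithTop.coe_lt_coe] at h
    exact ⟨v - t, sub_pos.2 h, by rw [add_sub_cancel]⟩

theorem coe_le_of_le {s t : ℝ} {v : WithTop ℝ} (hst : s ≤ t) (h : (t : WithTop ℝ) ≤ v) :
    (s : WithTop ℝ) ≤ v :=
  (WithTop.coe_le_coe.2 hst).trans h

theorem le_val_of_two_mul_le_val_sq {a : F} {s : ℝ}
    (h : ((2 * s : ℝ) : WithTop ℝ) ≤ val (a ^ 2)) : (s : WithTop ℝ) ≤ val a := by
  by_cases ha : a = 0
  · simp [ha]
  · rw [pow_two, le_val_iff_of_ne (mul_ne_zero ha ha), ord_mul ha ha] at h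
    rw [le_val_iff_of_ne ha]
    push_cast at h
    linarith

/-- If the depth at `x` is less than the depth, then `x` lies in an apartment in which the depth
at `x` is attained by the upper right entry. -/
theorem exists_upperCoord_val_eq (hp : ringChar 𝓀[F] ≠ 2) {x : Building F} {X : CoLie F}
    (hX : X ≠ 0) (hd : ((depthAt x X : ℝ) : EReal) < depth X) :
    ∃ (h : Grp F) (c : ℝ), x = point h c ∧
      val (upperCoord (coAd h⁻¹ X)) = ((depthAt x X - 2 * c : ℝ) : WithTop ℝ) := by
  rw [coe_lt_depth_iff hp] at hd
  obtain ⟨hmem, hnot⟩ := mem_coMP_depthAt x hX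
  generalize depthAt x X = t at *
  obtain ⟨h, c, rfl⟩ := exists_eq_point x
  have hm := (mem_coMP_iff h c t X).1 hmem
  by_contra! hno
  have hup := hno h c rfl
  -- The Weyl element exchanges the off-diagonal entries, so neither of them attains the depth.
  have hlow := hno (h * weyl⁻¹) (-c) (point_mul_weyl_inv h c).symm
  rw [_root_.mul_inv_rev, inv_inv, coAd_mul, upperCoord_weyl, val_neg, mul_neg,
    sub_neg_eq_add] at hlow
  obtain ⟨δ₁, h₁, hup⟩ := exists_pos_add_le (lt_of_le_of_ne hm.2.2 hup.symm)
  obtain ⟨δ₂, h₂, hlow⟩ := exists_pos_add_le (lt_of_le_of_ne hm.2.1 hlow.symm)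
  obtain ⟨δ₃, h₃, hd⟩ := exists_pos_add_le hd
  obtain ⟨δ, hδ, hδ₁, hδ₂, hδ₃⟩ : ∃ δ > 0, δ ≤ δ₁ ∧ δ ≤ δ₂ ∧ δ ≤ δ₃ :=
    ⟨min δ₁ (min δ₂ δ₃), lt_min h₁ (lt_min h₂ h₃), min_le_left _ _,
      (min_le_right _ _).trans (min_le_left _ _), (min_le_right _ _).trans (min_le_right _ _)⟩
  rw [← disc_coAd h⁻¹ X] at hd
  -- The square of the diagonal coordinate is `disc` minus four times the off-diagonal product, both
  -- of valuation at least `2 * t + δ`. Hence `X` has depth at least `t + δ / 2` at `x`, a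
  -- contradiction.
  have hA : ((2 * (t + δ / 2) : ℝ) : WithTop ℝ) ≤ val (diagCoord (coAd h⁻¹ X) ^ 2) := by
    rw [show diagCoord (coAd h⁻¹ X) ^ 2 =
        disc (coAd h⁻¹ X) + -(4 * upperCoord (coAd h⁻¹ X) * lowerCoord (coAd h⁻¹ X)) by
      rw [disc]
      ring]
    apply le_val_add
    · exact coe_le_of_le (by linarith) hd
    · rw [val_neg]
      exact coe_le_of_le (by linarith) (add_le_val_four_mul_mul hp hup hlow)
  apply hnot
  refine Set.mem_biUnion (x := t + δ / 2) (show t + δ / 2 > t by linarith) ?_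
  rw [mem_coMP_iff]
  exact ⟨le_val_of_two_mul_le_val_sq hA, coe_le_of_le (by linarith) hlow,
    coe_le_of_le (by linarith) hup⟩

theorem upperCoord_ne_zero_of_val_eq {X : CoLie F} {t : ℝ}
    (h : val (upperCoord X) = (t : WithTop ℝ)) : upperCoord X ≠ 0 := by
  intro h0
  simp [h0] at h

theorem depthAt_eq_of_val_upperCoord {h : Grp F} {c t : ℝ} {X : CoLie F}
    (hX : X ∈ coMP (point h c) t)
    (hu : val (upperCoord (coAd h⁻¹ X)) = ((t - 2 * c : ℝ) : WithTop ℝ)) :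
    depthAt (point h c) X = t := by
  refine depthAt_eq ?_ hX ?_
  · rintro rfl
    exact upperCoord_ne_zero_of_val_eq hu rfl
  · simp only [coMPplus, Set.mem_iUnion, not_exists]
    intro s hs hXs
    have := ((mem_coMP_iff _ _ _ _).1 hXs).2.2
    rw [hu, WithTop.coe_le_coe] at this
    linarith

/-- Adding an element of `𝔤*_{x,t+}` changes the dominant entry by something of larger valuation, so
its square class stays, and this class fixes the orbit of a nilpotent. -/
theorem orbit_eq_of_mem_coset (hp : ringChar 𝓀[F] ≠ 2) {h : Grp F} {c t : ℝ} {X Y : CoLie F}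
    (hu : val (upperCoord (coAd h⁻¹ X)) = ((t - 2 * c : ℝ) : WithTop ℝ))
    (hY : IsNilp Y) (hm : Y ∈ coset X (coMPplus (point h c) t)) :
    orbit Y = orbit (nilRep (upperCoord (coAd h⁻¹ X))) := by
  obtain ⟨Z, hZ, rfl⟩ := hm
  simp only [coMPplus, Set.mem_iUnion] at hZ
  obtain ⟨s, hs, hZ⟩ := hZ
  have hZu := ((mem_coMP_iff _ _ _ _).1 hZ).2.2
  obtain ⟨a, ha, hab⟩ := exists_eq_mul_sq hp (a := upperCoord (coAd h⁻¹ (X + Z)))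
    (b := upperCoord (coAd h⁻¹ X)) (by
      apply valuation_lt_of_val_lt
      rw [coAd_add, upperCoord_add, add_sub_cancel_left, hu]
      refine lt_of_lt_of_le (WithTop.coe_lt_coe.2 ?_) hZu
      linarith)
  have hne : upperCoord (coAd h⁻¹ (X + Z)) ≠ 0 := by
    rw [hab]
    exact mul_ne_zero (upperCoord_ne_zero_of_val_eq hu) (pow_ne_zero 2 ha)
  rw [← orbit_coAd h⁻¹ (X + Z), orbit_eq_orbit_nilRep (two_ne_zero_of_residue hp)
    (by rw [disc_coAd]; exact disc_eq_zero_of_isNilp hY) hne, hab, orbit_nilRep_mul_sq _ ha]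

/-- The coset of `X` modulo the lattice at `x` of level the depth of `X` meets the nilpotent orbit
given by the upper right entry. -/
theorem exists_mem_coset_of_val_upperCoord (hp : ringChar 𝓀[F] ≠ 2) {h : Grp F} {c t : ℝ}
    {X : CoLie F} (hd : (t : EReal) < depth X)
    (hu : val (upperCoord (coAd h⁻¹ X)) = ((t - 2 * c : ℝ) : WithTop ℝ)) :
    (orbit (nilRep (upperCoord (coAd h⁻¹ X))) ∩
      coset X (coMPExt (point h c) (depth X))).Nonempty := by
  have h2 := two_ne_zero_of_residue hp
  have h4 : (4 : F) ≠ 0 := by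
    rw [show (4 : F) = 2 * 2 by norm_num]
    exact mul_ne_zero h2 h2
  have hne := upperCoord_ne_zero_of_val_eq hu
  set b := upperCoord (coAd h⁻¹ X) with hb
  -- As `disc` is affine in the lower entry with slope `4 * b`, this correction makes it vanish.
  set Z : CoLie F := ofCoords 0 0 (-disc X / (4 * b)) with hZ
  have hY0 : upperCoord (coAd h⁻¹ X + Z) = b := by simp [hb, hZ]
  have hYd : disc (coAd h⁻¹ X + Z) = 0 := by
    rw [disc, hY0]
    simp only [diagCoord_add, lowerCoord_add, hZ, diagCoord_ofCoords, lowerCoord_ofCoords]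
    rw [← disc_coAd h⁻¹ X, disc, ← hb]
    field_simp
    ring
  refine ⟨coAd h (coAd h⁻¹ X + Z), ?_, coAd h Z, ?_, ?_⟩
  · rw [← hY0, ← orbit_eq_orbit_nilRep h2 hYd (by rwa [hY0])]
    exact ⟨h, rfl⟩
  · simp only [coMPExt, Set.mem_iInter]
    intro s hs
    -- The correction has valuation `ord (disc X) - ord b`, at least `2 * s - (t - 2 * c)`. This is
    -- at least the required `s + 2 * c` only when `t ≤ s`, so `s` is first raised to `max s t`.
    refine coMP_antitone _ (le_max_left s t) ?_
    have hs' : ((max s t : ℝ) : EReal) ≤ depth X := by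
      rcases max_choice s t with hst | hst <;> rw [hst]
      exacts [hs, hd.le]
    rw [coe_le_depth_iff hp] at hs'
    rw [mem_coMP_iff, coAd_inv_coAd]
    simp only [hZ, diagCoord_ofCoords, upperCoord_ofCoords, lowerCoord_ofCoords, val_zero, le_top,
      and_true, true_and]
    by_cases hD : disc X = 0
    · simp [hD]
    rw [le_val_iff_of_ne hD] at hs'
    rw [val_of_ne hne, WithTop.coe_eq_coe] at hu
    have hq : val (-disc X / (4 * b)) = ((ord (disc X) - ord b : ℝ) : WithTop ℝ) := by
      rw [show -disc X / (4 * b) = -((4 : F)⁻¹ * (disc X * b⁻¹)) by field_simp, val_neg, val_mul,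
        val_of_ne (inv_ne_zero h4), ord_inv h4,
        val_of_ne (mul_ne_zero hD (inv_ne_zero hne)), ord_mul hD (inv_ne_zero hne), ord_inv hne]
      have := val_four hp
      rw [val_of_ne h4] at this
      norm_cast at this ⊢
      rw [this]
      ring_nf
    rw [hq, WithTop.coe_le_coe]
    linarith [le_max_right s t]
  · simp [coAd_add]

theorem coset_coMPExt_depth_subset {x : Building F} {X : CoLie F} {t : ℝ}
    (hd : (t : EReal) < depth X) :
    coset X (coMPExt x (depth X)) ⊆ coset X (coMPplus x t) := by
  apply Set.image_mono
  obtain ⟨s, hts, hs⟩ := EReal.lt_iff_exists_real_btwn.1 hd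
  intro Z hZ
  simp only [coMPExt, Set.mem_iInter] at hZ
  exact Set.mem_biUnion (EReal.coe_lt_coe_iff.1 hts) (hZ s hs.le)

/-- A coset which meets a nilpotent orbit is at depth less than the depth of `X`. -/
theorem depthAt_lt_depth_of_nilp_mem_coset (hp : ringChar 𝓀[F] ≠ 2) {x : Building F}
    {X Y : CoLie F} (hX : X ≠ 0) (hY : IsNilp Y)
    (hm : Y ∈ coset X (coMPplus x (depthAt x X))) : ((depthAt x X : ℝ) : EReal) < depth X := by
  rw [coe_lt_depth_iff hp]
  have hmem := (mem_coMP_depthAt x hX).1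
  generalize depthAt x X = t at *
  obtain ⟨h, c, rfl⟩ := exists_eq_point x
  obtain ⟨Z, hZ, rfl⟩ := hm
  simp only [coMPplus, Set.mem_iUnion] at hZ
  obtain ⟨s, hs, hZ⟩ := hZ
  have hdY := disc_eq_zero_of_isNilp hY
  rw [← disc_coAd h⁻¹, coAd_add] at hdY
  rw [mem_coMP_iff] at hmem hZ
  rw [← disc_coAd h⁻¹ X]
  set A := coAd h⁻¹ X
  set D := coAd h⁻¹ Z
  -- Expanding `disc (A + D) = 0`: each term on the right has a factor from `D`, so its valuation is
  -- at least `t + s`, or `2 * s`, and exceeds `2 * t`.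
  have key : disc A = -(diagCoord A * diagCoord D + (diagCoord A * diagCoord D +
      (diagCoord D * diagCoord D + (4 * upperCoord A * lowerCoord D +
        (4 * upperCoord D * lowerCoord A + 4 * upperCoord D * lowerCoord D))))) := by
    simp only [disc, diagCoord_add, upperCoord_add, lowerCoord_add] at hdY ⊢
    linear_combination hdY
  have hst : 2 * t < t + s := by linarith [show t < s from hs]
  refine lt_of_lt_of_le (WithTop.coe_lt_coe.2 hst) ?_
  rw [key, val_neg]
  have hA := add_le_val_mul hmem.1 hZ.1
  refine le_val_add hA (le_val_add hA (le_val_add ?_ (le_val_add ?_ (le_val_add ?_ ?_))))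
  · exact coe_le_of_le (by linarith) (add_le_val_mul hZ.1 hZ.1)
  · exact coe_le_of_le (by linarith) (add_le_val_four_mul_mul hp hmem.2.2 hZ.2.1)
  · exact coe_le_of_le (by linarith) (add_le_val_four_mul_mul hp hZ.2.2 hmem.2.1)
  · exact coe_le_of_le (by linarith) (add_le_val_four_mul_mul hp hZ.2.2 hZ.2.1)

theorem isNilp_nilRep (hp : ringChar 𝓀[F] ≠ 2) (b : F) : IsNilp (nilRep b) :=
  isNilp_of_disc_eq_zero (two_ne_zero_of_residue hp) (disc_nilRep b)

theorem isNilp_of_mem_nilpOrbits {O : Set (CoLie F)} {Y : CoLie F}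
    (hp : ringChar 𝓀[F] ≠ 2) (hO : O ∈ nilpOrbits F) (hY : Y ∈ O) : IsNilp Y ∧ O = orbit Y := by
  obtain ⟨X, hX, rfl⟩ := hO
  refine ⟨?_, orbit_eq_of_mem hY⟩
  obtain ⟨g, rfl⟩ := hY
  rw [isNilp_iff (two_ne_zero_of_residue hp)] at hX ⊢
  rwa [disc_coAd]

/-- In an apartment where the depth at `x` is attained by the upper right entry `b`, the only
nilpotent orbit which meets the coset of `X` is that of `(0 b; 0 0)`. -/
theorem meetingOrbits_eq (hp : ringChar 𝓀[F] ≠ 2) {h : Grp F} {c : ℝ} {X : CoLie F}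
    (hd : ((depthAt (point h c) X : ℝ) : EReal) < depth X)
    (hu : val (upperCoord (coAd h⁻¹ X)) =
      ((depthAt (point h c) X - 2 * c : ℝ) : WithTop ℝ)) :
    meetingOrbits X (point h c) = {orbit (nilRep (upperCoord (coAd h⁻¹ X)))} := by
  ext O
  constructor
  · rintro ⟨hO, Y, hYO, hY⟩
    obtain ⟨hYn, rfl⟩ := isNilp_of_mem_nilpOrbits hp hO hYO
    exact orbit_eq_of_mem_coset hp hu hYn hY
  · rintro rfl
    obtain ⟨Y, hY, hYc⟩ := exists_mem_coset_of_val_upperCoord hp hd hu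
    exact ⟨⟨_, isNilp_nilRep hp _, rfl⟩, Y, hY, coset_coMPExt_depth_subset hd hYc⟩

/-- Only one nilpotent orbit meets the coset, so minimality is automatic. -/
theorem isOrbitAt_iff (hp : ringChar 𝓀[F] ≠ 2) {h : Grp F} {c : ℝ} {X : CoLie F}
    (hd : ((depthAt (point h c) X : ℝ) : EReal) < depth X)
    (hu : val (upperCoord (coAd h⁻¹ X)) =
      ((depthAt (point h c) X - 2 * c : ℝ) : WithTop ℝ)) (O : Set (CoLie F)) :
    IsOrbitAt X (point h c) O ↔ O = orbit (nilRep (upperCoord (coAd h⁻¹ X))) := by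
  rw [IsOrbitAt, meetingOrbits_eq hp hd hu]
  simp only [Set.mem_singleton_iff, forall_eq]
  exact ⟨And.left, fun hO => ⟨hO, hO ▸ subset_closure⟩⟩

theorem depthAt_lt_depth_of_isOrbitAt (hp : ringChar 𝓀[F] ≠ 2) {x : Building F} {X : CoLie F}
    (hX : X ≠ 0) {O : Set (CoLie F)} (hO : IsOrbitAt X x O) :
    ((depthAt x X : ℝ) : EReal) < depth X := by
  obtain ⟨⟨hO, Y, hYO, hY⟩, -⟩ := hO
  exact depthAt_lt_depth_of_nilp_mem_coset hp hX (isNilp_of_mem_nilpOrbits hp hO hYO).1 hY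

end Frame

/-! ### All the nilpotent supports coincide with the orbits of upper right entries. -/

section Support

variable {F : Type*} [Field F] [ValuativeRel F] [TopologicalSpace F] [IsNonarchimedeanLocalField F]

theorem mem_upperOrbits_of_isOrbitAt (hp : ringChar 𝓀[F] ≠ 2) {x : Building F} {X : CoLie F}
    (hX : X ≠ 0) {O : Set (CoLie F)} (hO : IsOrbitAt X x O) : O ∈ upperOrbits X := by
  have hd := depthAt_lt_depth_of_isOrbitAt hp hX hO
  obtain ⟨h, c, rfl, hu⟩ := exists_upperCoord_val_eq hp hX hd
  exact ⟨h⁻¹, upperCoord_ne_zero_of_val_eq hu, (isOrbitAt_iff hp hd hu O).1 hO⟩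

/-- Conjugating by a suitable diagonal element makes the upper right entry dominate. -/
theorem exists_diagElt_dominant (hp : ringChar 𝓀[F] ≠ 2) (c : ℝ) {X : CoLie F}
    (hX : upperCoord X ≠ 0) :
    ∃ s : Fˣ, ∀ h : Grp F, ∀ Y : CoLie F, coAd h⁻¹ Y = coAd (diagElt s) X →
      IsOrbitAt Y (point h c) (orbit (nilRep (upperCoord X))) := by
  obtain ⟨a, ha⟩ := exists_le_val (diagCoord X)
  obtain ⟨l, hl⟩ := exists_le_val (lowerCoord X)
  obtain ⟨d, hd⟩ := exists_le_val (disc X)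
  obtain ⟨b, hb⟩ : ∃ b : ℝ, b = (ord (upperCoord X) : ℝ) := ⟨_, rfl⟩
  obtain ⟨n, hn⟩ : ∃ n : ℤ, (n : ℝ) < min ((a - b - 2 * c) / 2)
      (min ((l - b - 4 * c) / 4) ((d - 2 * b - 4 * c) / 4)) := exists_int_lt _
  -- With `t = b + 2 * n + 2 * c`, the three bounds say that the diagonal entry has valuation above
  -- `t`, that the lower one, after scaling, has valuation above `t + 2 * c`, and that `2 * t` is
  -- less than the valuation of `disc`.
  rw [lt_min_iff, lt_min_iff] at hn
  obtain ⟨s, hs, hsn⟩ := exists_ord_eq (F := F) n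
  refine ⟨Units.mk0 s hs, fun h Y hY => ?_⟩
  have hs2 : ord (s ^ 2) = 2 * n := by rw [pow_two, ord_mul hs hs, hsn]; ring
  have hsi2 : ord (s⁻¹ ^ 2) = -(2 * n) := by
    rw [pow_two, ord_mul (inv_ne_zero hs) (inv_ne_zero hs), ord_inv hs, hsn]
    ring
  set t : ℝ := b + 2 * n + 2 * c with ht
  have hu : val (upperCoord (coAd h⁻¹ Y)) = ((t - 2 * c : ℝ) : WithTop ℝ) := by
    rw [hY, upperCoord_diagElt, Units.val_mk0, val_of_ne (mul_ne_zero (pow_ne_zero 2 hs) hX),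
      ord_mul (pow_ne_zero 2 hs) hX, hs2, WithTop.coe_eq_coe]
    push_cast
    rw [ht, hb]
    ring
  have hmem : Y ∈ coMP (point h c) t := by
    rw [mem_coMP_iff, hu, hY, diagCoord_diagElt, lowerCoord_diagElt, Units.val_mk0]
    refine ⟨coe_le_of_le (by linarith) ha, ?_, le_rfl⟩
    have hsv : ((-(2 * n) : ℝ) : WithTop ℝ) ≤ val (s⁻¹ ^ 2) := by
      rw [le_val_iff_of_ne (pow_ne_zero 2 (inv_ne_zero hs)), hsi2]
      push_cast
      exact le_rfl
    exact coe_le_of_le (by linarith) (add_le_val_mul hsv hl)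
  have hdepth := depthAt_eq_of_val_upperCoord hmem hu
  rw [isOrbitAt_iff hp]
  · rw [hY, upperCoord_diagElt, mul_comm, Units.val_mk0, orbit_nilRep_mul_sq _ hs]
  · rw [hdepth, coe_lt_depth_iff hp, ← disc_coAd h⁻¹ Y, hY, disc_coAd]
    exact lt_of_lt_of_le (WithTop.coe_lt_coe.2 (by linarith)) hd
  · rw [hdepth, hu]

theorem setOf_isOrbitAt_eq_upperOrbits (hp : ringChar 𝓀[F] ≠ 2) (x : Building F) {X : CoLie F}
    (hX : X ≠ 0) : {O | ∃ g : Grp F, IsOrbitAt (coAd g X) x O} = upperOrbits X := by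
  ext O
  constructor
  · rintro ⟨g, hO⟩
    rw [← upperOrbits_coAd g]
    exact mem_upperOrbits_of_isOrbitAt hp (coAd_ne_zero g hX) hO
  · rintro ⟨g, hg, rfl⟩
    obtain ⟨h, c, rfl⟩ := exists_eq_point x
    obtain ⟨s, hs⟩ := exists_diagElt_dominant hp c hg
    -- Here the point is fixed and the diagonal element moves `X`.
    exact ⟨h * diagElt s * g, hs _ _ (by rw [mul_assoc, coAd_mul, coAd_inv_coAd, coAd_mul])⟩

/-- The depth inequality costs nothing: the depth is invariant, and a degenerate coset forces the
inequality. -/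
theorem nilAt_eq_upperOrbits (hp : ringChar 𝓀[F] ≠ 2) (x : Building F) {X : CoLie F}
    (hX : X ≠ 0) : nilAt x X = upperOrbits X := by
  rw [← setOf_isOrbitAt_eq_upperOrbits hp x hX]
  ext O
  refine exists_congr fun g => ⟨And.right, fun hO => ⟨?_, hO⟩⟩
  rw [← depth_coAd hp g X]
  exact depthAt_lt_depth_of_isOrbitAt hp (coAd_ne_zero g hX) hO

theorem nil_eq_upperOrbits (hp : ringChar 𝓀[F] ≠ 2) {X : CoLie F} (hX : X ≠ 0) :
    nil X = upperOrbits X := by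
  ext O
  constructor
  · rintro ⟨x, -, hO⟩
    exact mem_upperOrbits_of_isOrbitAt hp hX hO
  · rintro ⟨g, hg, rfl⟩
    obtain ⟨s, hs⟩ := exists_diagElt_dominant hp 0 hg
    -- Here `X` is fixed and the inverse conjugation moves the point instead.
    have hO := hs (diagElt s * g)⁻¹ X (by rw [inv_inv, coAd_mul])
    exact ⟨_, depthAt_lt_depth_of_isOrbitAt hp hX hO, hO⟩

theorem mem_upperOrbits_of_subset_cone (hp : ringChar 𝓀[F] ≠ 2) {X : CoLie F}
    {O : Set (CoLie F)} (hO : O ∈ nilpOrbits F) (hO0 : O ≠ {0}) (hcone : O ⊆ cone X) :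
    O ∈ upperOrbits X := by
  obtain ⟨N, hN, rfl⟩ := hO
  have hN0 : N ≠ 0 := by
    rintro rfl
    apply hO0
    ext Y
    refine ⟨fun ⟨g, hg⟩ => hg.symm, fun hY => ?_⟩
    rw [Set.mem_singleton_iff.1 hY]
    exact mem_orbit_self 0
  obtain ⟨k, hk⟩ := exists_upperCoord_ne_zero hN0
  have horb := orbit_eq_orbit_nilRep (two_ne_zero_of_residue hp)
    (by rw [disc_coAd]; exact disc_eq_zero_of_isNilp hN) hk
  rw [orbit_coAd] at horb
  obtain ⟨ε, g, -, hlim⟩ := hcone ⟨k, rfl⟩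
  have hlim' := (continuous_upperCoord.tendsto _).comp hlim
  -- A single far term of the sequence suffices: its upper right entry has the square class of the
  -- limit, and dividing by `ε i ^ 2` keeps that class.
  obtain ⟨i, s, hs, hi⟩ := (hlim'.eventually (eventually_eq_mul_sq hp hk)).exists
  rw [Function.comp_apply, upperCoord_smul] at hi
  have hε : (ε i : F) ≠ 0 := (ε i).ne_zero
  have hi' : upperCoord (coAd (g i) X) = upperCoord (coAd k N) * (s / ε i) ^ 2 := by
    field_simp
    linear_combination hi
  have hsε : s / (ε i : F) ≠ 0 := div_ne_zero hs hε
  refine ⟨g i, ?_, ?_⟩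
  · rw [hi']
    exact mul_ne_zero hk (pow_ne_zero 2 hsε)
  · rw [hi', orbit_nilRep_mul_sq _ hsε, horb]

end Support

end SL2Nil

end

/-! ### The theorem. -/

open SL2Nil in
theorem propositionP {F : Type*} [Field F] [ValuativeRel F] [TopologicalSpace F]
    [IsNonarchimedeanLocalField F] (hp : ringChar 𝓀[F] ≠ 2)
    (Γ : CoLie F) (hΓ : Γ ≠ 0) :
    (∀ O ∈ nil Γ, ∃ x : Building F, ((depthAt x Γ : ℝ) : EReal) < depth Γ ∧
      (O ∩ coset Γ (coMPExt x (depth Γ))).Nonempty) ∧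
    (∀ x : Building F, ((depthAt x Γ : ℝ) : EReal) < depth Γ → ∀ O ∈ nilpOrbits F,
      (O ∩ coset Γ (coMPExt x (depth Γ))).Nonempty → O ∈ nil Γ) ∧
    (∀ x : Building F,
      nil Γ = {O | ∃ g : Grp F, IsOrbitAt (coAd g Γ) x O} ∧
      nil Γ = nilAt x Γ ∧
      ∀ O ∈ nilpOrbits F, O ≠ {0} → O ⊆ cone Γ → O ∈ nilAt x Γ) := by
  refine ⟨?_, ?_, fun x => ⟨?_, ?_, ?_⟩⟩
  · rintro O ⟨x, hd, hO⟩
    refine ⟨x, hd, ?_⟩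
    obtain ⟨h, c, rfl, hu⟩ := exists_upperCoord_val_eq hp hΓ hd
    rw [(isOrbitAt_iff hp hd hu O).1 hO]
    exact exists_mem_coset_of_val_upperCoord hp hd hu
  · rintro x hd O hO ⟨Y, hYO, hY⟩
    obtain ⟨h, c, rfl, hu⟩ := exists_upperCoord_val_eq hp hΓ hd
    refine ⟨_, hd, (isOrbitAt_iff hp hd hu O).2 ?_⟩
    obtain ⟨hYn, rfl⟩ := isNilp_of_mem_nilpOrbits hp hO hYO
    exact orbit_eq_of_mem_coset hp hu hYn (coset_coMPExt_depth_subset hd hY)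
  · rw [nil_eq_upperOrbits hp hΓ, setOf_isOrbitAt_eq_upperOrbits hp x hΓ]
  · rw [nil_eq_upperOrbits hp hΓ, nilAt_eq_upperOrbits hp x hΓ]
  · intro O hO hO0 hcone
    rw [nilAt_eq_upperOrbits hp x hΓ]
    exact mem_upperOrbits_of_subset_cone hp hO hO0 hcone
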